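/- Let $x_{n+1} = Ax_n + Bu_n + w_n$, $y_n = Cx_n + z_n + v_n$ ($n \ge 0$) with real matrices $A\in\mathbb{R}^{p\times p}$, $B\in\mathbb{R}^{p\times q}$, $C\in\mathbb{R}^{m\times p}$, where $(A,B)$ is stabilizable and $(A,C)$ is detectable. Let $K, L$ be gain matrices such that $A+BK$ and $A+LC$ are Schur stable (all eigenvalues in the open unit disc). The control input is $u_n = K\hat x_n + e_n$, where the observer is $\hat x_{n+1} = A\hat x_n + Bu_n + L(C\hat x_n - y_n)$. For a fixed $\alpha\in\mathbb{R}$, the attack on the measurements is $$v_n = \alpha(Cx_n + z_n) + C\xi_n + \zeta_n,\qquad \xi_{n+1} = (A+BK)\xi_n + \omega_n .$$ Here $w_n, z_n, e_n, \zeta_n, \omega_n$ ($n\ge 0$) are sequences of zero-mean Gaussian random vectors with respective constant (possibly singular) covariance matrices $\Sigma_W,\Sigma_Z,\Sigma_E,\Sigma_S,\Sigma_O$; all these vectors, together with the triple of (possibly deterministic) initial states $(x_0,\hat x_0,\xi_0)$, are mutually independent. Let $\Sigma_\Delta$ be the positive semidefinite solution of $$\Sigma_\Delta = (A+LC)\Sigma_\Delta(A+LC)^{\mathsf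 T} + \Sigma_W + L\Sigma_ZL^{\mathsf T}.$$ Suppose $\Sigma_E$ has full rank and $k' = \min\{k\ge 0 : C(A+BK)^kB \ne 0\}$ exists. If, almost surely, $$\lim_{N\to\infty}\frac1N\sum_{n=0}^{N-1}(C\hat x_n-y_n)(C\hat x_n-y_n)^{\mathsf T} = C\Sigma_\Delta C^{\mathsf T}+\Sigma_Z \quad\text{and}\quad \lim_{N\to\infty}\frac1N\sum_{n=0}^{N-1}(C\hat x_n-y_n)\,e_{n-k'-1}^{\mathsf T} = 0$$ (with $e_j = 0$ for $j<0$), then $\alpha = 0$ and, almost surely, $$\lim_{N\to\infty}\frac1N\sum_{n=0}^{N-1}v_n^{\mathsf T}v_n = 0 .$$ -/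

import Mathlib

open Filter Topology MeasureTheory ProbabilityTheory
open scoped Matrix

/-- A real square matrix is Schur stable if all of its complex eigenvalues lie in the open unit
disc. -/
def IsSchurStable {d : ℕ} (M : Matrix (Fin d) (Fin d) ℝ) : Prop :=
  ∀ μ ∈ spectrum ℂ (M.map (fun t : ℝ => (t : ℂ))), ‖μ‖ < 1

/-- `(A, B)` is stabilizable: some static state feedback makes `A + B K` Schur stable. -/
def IsStabilizable {p q : ℕ} (A : Matrix (Fin p) (Fin p) ℝ) (B : Matrix (Fin p) (Fin q) ℝ) :
    Prop :=
  ∃ K : Matrix (Fin q) (Fin p) ℝ, IsSchurStable (A + B * K)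

/-- `(A, C)` is detectable: some output injection makes `A + L C` Schur stable. -/
def IsDetectable {p m : ℕ} (A : Matrix (Fin p) (Fin p) ℝ) (C : Matrix (Fin m) (Fin p) ℝ) :
    Prop :=
  ∃ L : Matrix (Fin p) (Fin m) ℝ, IsSchurStable (A + L * C)

/-- The terms of the sequence `g` are zero mean (jointly) Gaussian random vectors with covariance
matrix `S`, which may be singular. Independence is imposed separately, see `SourcesIndependent`. -/
structure IsGaussianNoise {Ω : Type*} [MeasurableSpace Ω] {d : ℕ} (P : Measure Ω)
    (g : ℕ → Ω → Fin d → ℝ) (S : Matrix (Fin d) (Fin d) ℝ) : Prop where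
  measurable : ∀ n, Measurable (g n)
  gaussian : ∀ n, HasGaussianLaw (g n) P
  mean_zero : ∀ n i, ∫ a, g n a i ∂P = 0
  covariance : ∀ n i j, ∫ a, g n a i * g n a j ∂P = S i j

/-- The sources of randomness: the initial states, and, at each time `n`, the process noise `w n`,
the measurement noise `z n`, the private excitation `e n`, and the two noises `ζ n` and `ω n` of
the attacker. -/
inductive Source : Type
  | initial : Source
  | process : ℕ → Source
  | measurement : ℕ → Source
  | excitation : ℕ → Source
  | attackOutput : ℕ → Source
  | attackState : ℕ → Source

/-- The sigma-algebra generated by a source of randomness. -/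
@[reducible]
def Source.sigmaAlgebra {Ω : Type*} {p q m : ℕ} (x₀ xhat₀ ξ₀ : Ω → Fin p → ℝ)
    (w : ℕ → Ω → Fin p → ℝ) (z : ℕ → Ω → Fin m → ℝ) (e : ℕ → Ω → Fin q → ℝ)
    (ζ : ℕ → Ω → Fin m → ℝ) (ω : ℕ → Ω → Fin p → ℝ) : Source → MeasurableSpace Ω
  | .initial => MeasurableSpace.comap (fun a => (x₀ a, xhat₀ a, ξ₀ a)) inferInstance
  | .process n => MeasurableSpace.comap (w n) inferInstance
  | .measurement n => MeasurableSpace.comap (z n) inferInstance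
  | .excitation n => MeasurableSpace.comap (e n) inferInstance
  | .attackOutput n => MeasurableSpace.comap (ζ n) inferInstance
  | .attackState n => MeasurableSpace.comap (ω n) inferInstance

/-- The triple of initial states and all the noise vectors `w n`, `z n`, `e n`, `ζ n`, `ω n`,
`n ≥ 0`, are mutually independent. (The three initial states may depend on each other; they may
also be deterministic.) -/
def SourcesIndependent {Ω : Type*} [MeasurableSpace Ω] {p q m : ℕ} (P : Measure Ω)
    (x₀ xhat₀ ξ₀ : Ω → Fin p → ℝ) (w : ℕ → Ω → Fin p → ℝ) (z : ℕ → Ω → Fin m → ℝ)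
    (e : ℕ → Ω → Fin q → ℝ) (ζ : ℕ → Ω → Fin m → ℝ) (ω : ℕ → Ω → Fin p → ℝ) : Prop :=
  iIndep (Source.sigmaAlgebra x₀ xhat₀ ξ₀ w z e ζ ω) P

/-- The closed loop: plant `x`, observer `xhat` with gain `L`, control input
`u = K xhat + e` with private excitation `e`, and output `y` corrupted by the attack `v`. -/
structure IsClosedLoop {Ω : Type*} {p q m : ℕ}
    (A : Matrix (Fin p) (Fin p) ℝ) (B : Matrix (Fin p) (Fin q) ℝ) (C : Matrix (Fin m) (Fin p) ℝ)
    (K : Matrix (Fin q) (Fin p) ℝ) (L : Matrix (Fin p) (Fin m) ℝ)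
    (x xhat : ℕ → Ω → Fin p → ℝ) (u : ℕ → Ω → Fin q → ℝ) (y v : ℕ → Ω → Fin m → ℝ)
    (w : ℕ → Ω → Fin p → ℝ) (z : ℕ → Ω → Fin m → ℝ) (e : ℕ → Ω → Fin q → ℝ) : Prop where
  state : ∀ n a, x (n + 1) a = A *ᵥ x n a + B *ᵥ u n a + w n a
  output : ∀ n a, y n a = C *ᵥ x n a + z n a + v n a
  input : ∀ n a, u n a = K *ᵥ xhat n a + e n a
  observer : ∀ n a,
    xhat (n + 1) a = A *ᵥ xhat n a + B *ᵥ u n a + L *ᵥ (C *ᵥ xhat n a - y n a)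

/-- The attack model: `v = α (C x + z) + C ξ + ζ`, where the false state `ξ` evolves with
`A + B K` and is driven by `ω`. -/
structure IsAttack {Ω : Type*} {p q m : ℕ}
    (A : Matrix (Fin p) (Fin p) ℝ) (B : Matrix (Fin p) (Fin q) ℝ) (C : Matrix (Fin m) (Fin p) ℝ)
    (K : Matrix (Fin q) (Fin p) ℝ) (α : ℝ)
    (x ξ : ℕ → Ω → Fin p → ℝ) (z v ζ : ℕ → Ω → Fin m → ℝ) (ω : ℕ → Ω → Fin p → ℝ) : Prop where
  attack : ∀ n a, v n a = α • (C *ᵥ x n a + z n a) + C *ᵥ ξ n a + ζ n a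
  falseState : ∀ n a, ξ (n + 1) a = (A + B * K) *ᵥ ξ n a + ω n a

/-- `SΔ` is a positive semidefinite solution of the Lyapunov equation
`SΔ = (A + L C) SΔ (A + L C)ᵀ + SW + L SZ Lᵀ` (unique when `A + L C` is Schur stable). -/
def IsErrorCovariance {p m : ℕ} (A : Matrix (Fin p) (Fin p) ℝ) (C : Matrix (Fin m) (Fin p) ℝ)
    (L : Matrix (Fin p) (Fin m) ℝ) (SW : Matrix (Fin p) (Fin p) ℝ)
    (SZ : Matrix (Fin m) (Fin m) ℝ) (SΔ : Matrix (Fin p) (Fin p) ℝ) : Prop :=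
  SΔ.PosSemidef ∧ SΔ = (A + L * C) * SΔ * (A + L * C)ᵀ + SW + L * SZ * Lᵀ

/-- The innovation `C xhat - y`. -/
def innovation {Ω : Type*} {p m : ℕ} (C : Matrix (Fin m) (Fin p) ℝ) (xhat : ℕ → Ω → Fin p → ℝ)
    (y : ℕ → Ω → Fin m → ℝ) (n : ℕ) (a : Ω) : Fin m → ℝ :=
  C *ᵥ xhat n a - y n a

/-- The sequence `e` delayed by `d` steps, `n ↦ e (n - d)`, with `e` extended by zero to negative
times. -/
def delayed {Ω : Type*} {q : ℕ} (e : ℕ → Ω → Fin q → ℝ) (d n : ℕ) (a : Ω) : Fin q → ℝ :=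
  if d ≤ n then e (n - d) a else 0

/-- First test: almost surely, `(1/N) ∑_{n<N} (C xhat - y)(C xhat - y)ᵀ → C SΔ Cᵀ + SZ`. -/
def CovarianceTest {Ω : Type*} [MeasurableSpace Ω] {p m : ℕ} (P : Measure Ω)
    (C : Matrix (Fin m) (Fin p) ℝ) (SZ : Matrix (Fin m) (Fin m) ℝ)
    (SΔ : Matrix (Fin p) (Fin p) ℝ) (xhat : ℕ → Ω → Fin p → ℝ) (y : ℕ → Ω → Fin m → ℝ) : Prop :=
  ∀ᵐ a ∂P, Tendsto
    (fun N : ℕ => (1 / (N : ℝ)) • ∑ n ∈ Finset.range N,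
      Matrix.vecMulVec (innovation C xhat y n a) (innovation C xhat y n a))
    atTop (𝓝 (C * SΔ * Cᵀ + SZ))

/-- Second test: almost surely, `(1/N) ∑_{n<N} (C xhat - y) e_{n-k'-1}ᵀ → 0`. -/
def CorrelationTest {Ω : Type*} [MeasurableSpace Ω] {p q m : ℕ} (P : Measure Ω)
    (C : Matrix (Fin m) (Fin p) ℝ) (k' : ℕ) (xhat : ℕ → Ω → Fin p → ℝ)
    (y : ℕ → Ω → Fin m → ℝ) (e : ℕ → Ω → Fin q → ℝ) : Prop :=
  ∀ᵐ a ∂P, Tendsto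
    (fun N : ℕ => (1 / (N : ℝ)) • ∑ n ∈ Finset.range N,
      Matrix.vecMulVec (innovation C xhat y n a) (delayed e (k' + 1) n a))
    atTop (𝓝 (0 : Matrix (Fin m) (Fin q) ℝ))

/-- `v` asymptotically has zero average power: almost surely, `(1/N) ∑_{n<N} vᵀ v → 0`. -/
def HasZeroAveragePower {Ω : Type*} [MeasurableSpace Ω] {m : ℕ} (P : Measure Ω)
    (v : ℕ → Ω → Fin m → ℝ) : Prop :=
  ∀ᵐ a ∂P, Tendsto
    (fun N : ℕ => (1 / (N : ℝ)) * ∑ n ∈ Finset.range N, v n a ⬝ᵥ v n a) atTop (𝓝 0)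

/-! The argument runs along sample paths and uses time averages only. The plant state, the observer
error `xhat - x` and the false state form one linear system driven by a joint white noise, with the
innovation as output. The probabilistic engine is `ae_hasMean_mul_noise`: a predictable sequence of
bounded average power is empirically uncorrelated with the noise that follows it (L²-bounded
martingales converge, then Kronecker's lemma).

Scaling. For `α ≠ 0` the loop may be unstable, so there need not be a stationary covariance. But the
covariance test itself gives the innovation bounded average power, and this is enough for its
empirical correlation with past noise to equal the impulse response times the noise covariance
(`ae_hasMean_output_mul_noise`). At the first lag where the excitation is felt, this response is `-α
C (A + B K)^k' B Σ_E` (`loop_impulse_response`): as long as `C (A + B K)^k B` vanishes, the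
excitation stays in the plant state and does not reach the observer. The correlation test makes the
response zero, and the full rank of `Σ_E` yields `α = 0`.

Covariance. For `α = 0` the observer error and the false state form a stable block triangular
system, whose empirical output covariance comes from a Lyapunov equation (`ae_hasMatMean_output`).
Its solution is additive in the noise covariance. The part without attack is what the test
prescribes, so the part due to the attack noises must vanish. It is a sum of positive semidefinite
terms, hence each is zero (`eq_zero_of_stein_output`). So `Σ_S = 0` and `C (A + B K)^k Σ_O = 0` for
all `k`. The limiting covariance of `v = C ξ + ζ` is then zero, and its trace is the average power.
-/

/-- The time averages of the real sequence `a` converge to `l`. -/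
def HasMean (a : ℕ → ℝ) (l : ℝ) : Prop :=
  Tendsto (fun N : ℕ => (1 / (N : ℝ)) * ∑ n ∈ Finset.range N, a n) atTop (𝓝 l)

/-- The real sequence `a` has bounded average power. -/
def BddPower (a : ℕ → ℝ) : Prop :=
  ∃ c : ℝ, ∀ N : ℕ, ∑ n ∈ Finset.range N, a n ^ 2 ≤ c * N

/-! ### Calculus of time averages and of bounded average power. -/

namespace HasMean

variable {a b : ℕ → ℝ} {k l : ℝ}

theorem add (ha : HasMean a k) (hb : HasMean b l) : HasMean (fun n => a n + b n) (k + l) := by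
  unfold HasMean at *
  simpa only [Finset.sum_add_distrib, mul_add] using Tendsto.add ha hb

theorem const_mul (c : ℝ) (ha : HasMean a k) : HasMean (fun n => c * a n) (c * k) := by
  unfold HasMean at *
  simpa only [← Finset.mul_sum, mul_left_comm] using Tendsto.const_mul c ha

theorem zero : HasMean (fun _ => 0) 0 := by
  simp [HasMean]

theorem sum {ι : Type*} (s : Finset ι) {f : ι → ℕ → ℝ} {g : ι → ℝ}
    (h : ∀ i ∈ s, HasMean (f i) (g i)) : HasMean (fun n => ∑ i ∈ s, f i n) (∑ i ∈ s, g i) := by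
  classical
  induction s using Finset.induction_on with
  | empty => simpa using zero
  | insert i s hi ih =>
    simp only [Finset.sum_insert hi]
    exact (h i (by simp)).add (ih fun j hj => h j (by simp [hj]))

theorem const (c : ℝ) : HasMean (fun _ => c) c := by
  refine tendsto_const_nhds.congr' ?_
  filter_upwards [eventually_gt_atTop 0] with N hN
  have : (N : ℝ) ≠ 0 := by positivity
  simp [this]

theorem unique (h : HasMean a k) (h' : HasMean a l) : k = l :=
  tendsto_nhds_unique h h'

theorem congr (h : HasMean a k) (hab : ∀ n, a n = b n) : HasMean b k := by
  rwa [← funext hab]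

theorem succ (h : HasMean a k) : HasMean (fun n => a (n + 1)) k := by
  have h1 : Tendsto (fun N : ℕ => ((N : ℝ) + 1) / N) atTop (𝓝 1) := by
    have := (tendsto_natCast_div_add_atTop (1 : ℝ)).inv₀ one_ne_zero
    simpa only [inv_div, inv_one] using this
  have h2 := (h1.mul ((tendsto_add_atTop_iff_nat 1).2 h)).sub
    ((tendsto_const_div_atTop_nhds_zero_nat (a 0)))
  simp only [one_mul, sub_zero] at h2
  refine h2.congr' ?_
  filter_upwards [eventually_gt_atTop 0] with N hN
  have : (N : ℝ) ≠ 0 := by positivity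
  rw [Finset.sum_range_succ']
  push_cast
  field_simp
  ring

theorem shift (h : HasMean a k) (d : ℕ) : HasMean (fun n => a (n + d)) k := by
  induction d with
  | zero => exact h
  | succ d ih => exact ih.succ.congr fun n => by congr 1; ring

/-- Up to factors tending to one, the last term divided by its index is the difference of two
consecutive averages, which share their limit. -/
theorem tendsto_div (h : HasMean a k) : Tendsto (fun N : ℕ => a N / (N + 1)) atTop (𝓝 0) := by
  have h1 : Tendsto (fun N : ℕ => (N : ℝ) / (N + 1)) atTop (𝓝 1) :=
    tendsto_natCast_div_add_atTop 1
  have h2 := ((tendsto_add_atTop_iff_nat 1).2 h).sub (h1.mul h)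
  simp only [one_mul, sub_self] at h2
  refine h2.congr' ?_
  filter_upwards [eventually_gt_atTop 0] with N hN
  have : (N : ℝ) ≠ 0 := by positivity
  rw [Finset.sum_range_succ]
  push_cast
  field_simp
  ring

/-- Convergent averages are bounded. This turns the covariance test into a growth bound on the
innovation. -/
theorem bddPower (h : HasMean (fun n => a n ^ 2) k) : BddPower a := by
  obtain ⟨c, hc⟩ := h.bddAbove_range
  refine ⟨c, fun N => ?_⟩
  rcases N.eq_zero_or_pos with rfl | hN
  · simp
  have := hc ⟨N, rfl⟩
  simp only [one_div] at this
  rwa [inv_mul_le_iff₀ (by positivity), mul_comm] at this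

end HasMean

namespace BddPower

variable {a b : ℕ → ℝ}

theorem add (ha : BddPower a) (hb : BddPower b) : BddPower (fun n => a n + b n) := by
  obtain ⟨c, hc⟩ := ha
  obtain ⟨d, hd⟩ := hb
  refine ⟨2 * (c + d), fun N => ?_⟩
  calc ∑ n ∈ Finset.range N, (a n + b n) ^ 2
      ≤ ∑ n ∈ Finset.range N, (2 * a n ^ 2 + 2 * b n ^ 2) :=
        Finset.sum_le_sum fun n _ => by nlinarith [sq_nonneg (a n - b n)]
    _ = 2 * ∑ n ∈ Finset.range N, a n ^ 2 + 2 * ∑ n ∈ Finset.range N, b n ^ 2 := by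
        rw [Finset.sum_add_distrib, Finset.mul_sum, Finset.mul_sum]
    _ ≤ _ := by linarith [hc N, hd N]

theorem const_mul (r : ℝ) (ha : BddPower a) : BddPower (fun n => r * a n) := by
  obtain ⟨c, hc⟩ := ha
  refine ⟨r ^ 2 * c, fun N => ?_⟩
  simp only [mul_pow, ← Finset.mul_sum, mul_assoc]
  exact mul_le_mul_of_nonneg_left (hc N) (sq_nonneg r)

theorem sub (ha : BddPower a) (hb : BddPower b) : BddPower (fun n => a n - b n) := by
  simpa [sub_eq_add_neg] using ha.add (hb.const_mul (-1))

theorem sum {ι : Type*} (s : Finset ι) {f : ι → ℕ → ℝ} (h : ∀ i ∈ s, BddPower (f i)) :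
    BddPower (fun n => ∑ i ∈ s, f i n) := by
  classical
  induction s using Finset.induction_on with
  | empty => exact ⟨0, by simp⟩
  | insert i s hi ih =>
    simp only [Finset.sum_insert hi]
    exact (h i (by simp)).add (ih fun j hj => h j (by simp [hj]))

theorem mono (hb : BddPower b) (h : ∀ n, |a n| ≤ |b n|) : BddPower a := by
  obtain ⟨c, hc⟩ := hb
  exact ⟨c, fun N => (Finset.sum_le_sum fun n _ => sq_le_sq.2 (h n)).trans (hc N)⟩

theorem succ (ha : BddPower a) : BddPower (fun n => a (n + 1)) := by
  obtain ⟨c, hc⟩ := ha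
  have hc0 : 0 ≤ c := by
    have := hc 1
    simp only [Finset.range_one, Finset.sum_singleton, Nat.cast_one, mul_one] at this
    nlinarith [sq_nonneg (a 0)]
  refine ⟨2 * c, fun N => ?_⟩
  rcases N.eq_zero_or_pos with rfl | hN
  · simp
  have h1 := hc (N + 1)
  rw [Finset.sum_range_succ'] at h1
  have : (1 : ℝ) ≤ N := by exact_mod_cast hN
  push_cast at h1
  nlinarith [sq_nonneg (a 0)]

theorem shift (h : BddPower a) (d : ℕ) : BddPower (fun n => a (n + d)) := by
  induction d with
  | zero => exact h
  | succ d ih => simpa only [add_assoc, add_comm 1 d] using ih.succ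

/-- Summation by parts: bounded average power makes `a n / (n + 1)` square summable. -/
theorem exists_sum_div_sq_le (ha : BddPower a) :
    ∃ R : ℝ, ∀ N : ℕ, ∑ n ∈ Finset.range N, (a n / (n + 1)) ^ 2 ≤ R := by
  obtain ⟨c, hc⟩ := ha
  have hc0 : 0 ≤ c := by
    have := hc 1
    simp only [Finset.range_one, Finset.sum_singleton, Nat.cast_one, mul_one] at this
    nlinarith [sq_nonneg (a 0)]
  -- The first term on the right is the boundary term of the summation by parts. The second is a
  -- telescoping majorant: the partial sum of squares is at most `c (t + 1)`, and the decrement of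
  -- `1 / (t + 1) ^ 2` costs only a multiple of that of `1 / (t + 1)`.
  have key : ∀ N : ℕ, ∑ n ∈ Finset.range N, (a n / (n + 1)) ^ 2 ≤
      (∑ n ∈ Finset.range N, a n ^ 2) / (N + 1) ^ 2 + 2 * c * (1 - 1 / (N + 1)) := by
    intro N
    induction N with
    | zero => simp
    | succ N ih =>
      have hS := hc (N + 1)
      rw [Finset.sum_range_succ, Finset.sum_range_succ _ N] at *
      set S := ∑ n ∈ Finset.range N, a n ^ 2
      push_cast at *
      have ht0 : (0 : ℝ) ≤ N := Nat.cast_nonneg N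
      generalize (N : ℝ) = t at *
      have h3 : (S + a N ^ 2) * (1 / (t + 1) ^ 2 - 1 / (t + 1 + 1) ^ 2) ≤
          2 * c * (1 / (t + 1) - 1 / (t + 1 + 1)) := by
        have e1 : 1 / (t + 1) ^ 2 - 1 / (t + 1 + 1) ^ 2 =
            (2 * t + 3) / ((t + 1) ^ 2 * (t + 1 + 1) ^ 2) := by
          field_simp; ring
        have e2 : 2 * c * (1 / (t + 1) - 1 / (t + 1 + 1)) =
            2 * c * (t + 1) * (t + 1 + 1) / ((t + 1) ^ 2 * (t + 1 + 1) ^ 2) := by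
          field_simp; ring
        rw [e1, e2, ← mul_div_assoc]
        refine div_le_div_of_nonneg_right ?_ (by positivity)
        nlinarith [mul_nonneg hc0 ht0,
          mul_le_mul_of_nonneg_right hS (by positivity : 0 ≤ 2 * t + 3)]
      have h4 : (a N / (t + 1)) ^ 2 = a N ^ 2 * (1 / (t + 1) ^ 2) := by
        rw [div_pow]; ring
      rw [h4]
      simp only [div_eq_mul_one_div S, div_eq_mul_one_div (S + a N ^ 2)] at *
      linarith
  refine ⟨c + 2 * c, fun N => (key N).trans ?_⟩
  have hN : (0 : ℝ) ≤ N := Nat.cast_nonneg N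
  refine add_le_add ?_ ?_
  · rw [div_le_iff₀ (by positivity)]
    refine (hc N).trans (mul_le_mul_of_nonneg_left (by nlinarith) hc0)
  · have : 0 ≤ 1 / ((N : ℝ) + 1) := by positivity
    nlinarith [mul_nonneg hc0 this]

end BddPower

/-- Kronecker's lemma for time averages. -/
theorem HasMean.of_tendsto_sum_div {x : ℕ → ℝ} {l : ℝ}
    (h : Tendsto (fun N => ∑ n ∈ Finset.range N, x n / (n + 1)) atTop (𝓝 l)) : HasMean x 0 := by
  have h2 := h.sub h.cesaro
  rw [sub_self] at h2
  refine h2.congr' ?_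
  filter_upwards [eventually_gt_atTop 0] with N hN
  -- Abel summation: after division by `N`, a convergent sequence minus its own Cesàro mean.
  have key : ∀ N : ℕ, ∑ n ∈ Finset.range N, x n =
      N * (∑ n ∈ Finset.range N, x n / (n + 1)) -
        ∑ k ∈ Finset.range N, ∑ n ∈ Finset.range k, x n / (n + 1) := by
    intro N
    induction N with
    | zero => simp
    | succ N ih =>
      rw [Finset.sum_range_succ, ih, Finset.sum_range_succ (fun n : ℕ => x n / (n + 1)) N,
        Finset.sum_range_succ (fun k => ∑ n ∈ Finset.range k, x n / (n + 1)) N]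
      push_cast
      field_simp
      ring
  have : (N : ℝ) ≠ 0 := by positivity
  rw [key N]
  field_simp

/-! ### Martingale transforms of scalar noise and their law of large numbers. -/

section MartingaleTransform

variable {Ω : Type*} {mΩ : MeasurableSpace Ω} {P : Measure Ω}
  {ℱ : Filtration ℕ mΩ} {h η : ℕ → Ω → ℝ} {σ R : ℝ}

/-- A scalar white noise: `η n` is revealed at time `n + 1`, is independent of the past `ℱ n`,
centered, and has uniformly bounded variance. -/
structure IsScalarNoise (P : Measure Ω) (ℱ : Filtration ℕ mΩ) (η : ℕ → Ω → ℝ) (σ : ℝ) :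
    Prop where
  measurable : ∀ n, Measurable[ℱ (n + 1)] (η n)
  indep : ∀ n, Indep (MeasurableSpace.comap (η n) inferInstance) (ℱ n) P
  memLp : ∀ n, MemLp (η n) 2 P
  mean_zero : ∀ n, ∫ a, η n a ∂P = 0
  variance_le : ∀ n, ∫ a, η n a ^ 2 ∂P ≤ σ

theorem IsScalarNoise.measurable' (hη : IsScalarNoise P ℱ η σ) (n : ℕ) : Measurable (η n) :=
  (hη.measurable n).mono (ℱ.le _) le_rfl

theorem IsScalarNoise.indepFun (hη : IsScalarNoise P ℱ η σ) {n : ℕ} {f : Ω → ℝ}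
    (hf : Measurable[ℱ n] f) : IndepFun f (η n) P := by
  rw [IndepFun_iff_Indep]
  exact (indep_of_indep_of_le_right (hη.indep n) hf.comap_le).symm

theorem measurable_transform (hh : ∀ n, Measurable[ℱ n] (h n))
    (hη : IsScalarNoise P ℱ η σ) (N : ℕ) :
    Measurable[ℱ N] (fun a => ∑ n ∈ Finset.range N, h n a * η n a) := by
  refine Finset.measurable_fun_sum _ fun n hn => ?_
  have hn : n + 1 ≤ N := Finset.mem_range.1 hn
  exact ((hh n).mono (ℱ.mono (by omega)) le_rfl).mul
    ((hη.measurable n).mono (ℱ.mono hn) le_rfl)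

theorem memLp_transform (hh : ∀ n, Measurable[ℱ n] (h n))
    (hη : IsScalarNoise P ℱ η σ) {c : ℝ} (hc : ∀ n a, |h n a| ≤ c) (N : ℕ) :
    MemLp (fun a => ∑ n ∈ Finset.range N, h n a * η n a) 2 P := by
  refine memLp_finsetSum _ fun n _ => ?_
  refine MemLp.of_le_mul (c := c) (hη.memLp n)
    (((hh n).mono (ℱ.le n) le_rfl).mul (hη.measurable' n)).aestronglyMeasurable
    (ae_of_all _ fun a => ?_)
  rw [norm_mul]
  exact mul_le_mul_of_nonneg_right (hc n a) (norm_nonneg _)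

variable [IsProbabilityMeasure P]

/-- Increments are orthogonal: `η N` is centered and independent of `ℱ N`, so the cross term
vanishes and the square of the new increment factors. The bound `c` serves integrability only and is
absent from the estimate. -/
theorem integral_sq_transform_le (hh : ∀ n, Measurable[ℱ n] (h n))
    (hη : IsScalarNoise P ℱ η σ) {c : ℝ} (hc : ∀ n a, |h n a| ≤ c) (N : ℕ) :
    ∫ a, (∑ n ∈ Finset.range N, h n a * η n a) ^ 2 ∂P ≤
      σ * ∫ a, ∑ n ∈ Finset.range N, h n a ^ 2 ∂P := by
  have hh' : ∀ n, Measurable (h n) := fun n => (hh n).mono (ℱ.le n) le_rfl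
  have hhL : ∀ n, MemLp (h n) ⊤ P := fun n =>
    memLp_top_of_bound (hh' n).aestronglyMeasurable c (ae_of_all _ (hc n))
  have hhI : ∀ n, Integrable (fun a => h n a ^ 2) P := fun n =>
    ((hhL n).mono_exponent (p := 2) le_top).integrable_sq
  induction N with
  | zero => simp
  | succ N ih =>
    simp only [Finset.sum_range_succ]
    set M : Ω → ℝ := fun a => ∑ n ∈ Finset.range N, h n a * η n a with hM
    have hMm : Measurable[ℱ N] M := measurable_transform hh hη N
    have hML : MemLp M 2 P := memLp_transform hh hη hc N
    have hMh : MemLp (fun a => M a * h N a) 2 P := by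
      refine MemLp.of_le_mul (c := c) hML
        ((hMm.mono (ℱ.le N) le_rfl).mul (hh' N)).aestronglyMeasurable (ae_of_all _ fun a => ?_)
      rw [norm_mul, mul_comm]
      exact mul_le_mul_of_nonneg_right (hc N a) (norm_nonneg _)
    have hcross : ∫ a, (M a * h N a) * η N a ∂P = 0 := by
      have hi : IndepFun (fun a => M a * h N a) (η N) P := hη.indepFun (hMm.mul (hh N))
      rw [hi.integral_fun_mul_eq_mul_integral hMh.aestronglyMeasurable
        (hη.memLp N).aestronglyMeasurable, hη.mean_zero, mul_zero]
    have hsq : ∫ a, h N a ^ 2 * η N a ^ 2 ∂P = (∫ a, h N a ^ 2 ∂P) * ∫ a, η N a ^ 2 ∂P := by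
      have hi : IndepFun (fun a => h N a ^ 2) (fun a => η N a ^ 2) P :=
        (hη.indepFun (hh N)).comp (φ := fun t => t ^ 2) (ψ := fun t => t ^ 2)
          (by fun_prop) (by fun_prop)
      exact hi.integral_fun_mul_eq_mul_integral ((hh' N).pow_const 2).aestronglyMeasurable
        ((hη.measurable' N).pow_const 2).aestronglyMeasurable
    have hsqI : Integrable (fun a => h N a ^ 2 * η N a ^ 2) P := by
      refine Integrable.bdd_mul (c := c ^ 2) (hη.memLp N).integrable_sq
        ((hh' N).pow_const 2).aestronglyMeasurable (ae_of_all _ fun a => ?_)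
      rw [norm_pow]
      exact pow_le_pow_left₀ (norm_nonneg _) (hc N a) 2
    have hcrossI : Integrable (fun a => (M a * h N a) * η N a) P := hMh.integrable_mul (hη.memLp N)
    have e : ∀ a, (M a + h N a * η N a) ^ 2 =
        M a ^ 2 + (2 * ((M a * h N a) * η N a) + h N a ^ 2 * η N a ^ 2) := fun a => by ring
    have hI : Integrable (fun a => 2 * ((M a * h N a) * η N a) + h N a ^ 2 * η N a ^ 2) P :=
      (hcrossI.const_mul 2).add hsqI
    have hL : ∫ a, (M a + h N a * η N a) ^ 2 ∂P =
        ∫ a, M a ^ 2 ∂P + (∫ a, h N a ^ 2 ∂P) * ∫ a, η N a ^ 2 ∂P := by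
      simp only [e]
      rw [integral_add hML.integrable_sq hI, integral_add (hcrossI.const_mul 2) hsqI,
        integral_const_mul, hcross, hsq, mul_zero, zero_add]
    change ∫ a, (M a + h N a * η N a) ^ 2 ∂P ≤ _
    rw [hL, integral_add (integrable_finsetSum _ fun n _ => hhI n) (hhI N), mul_add]
    have := mul_le_mul_of_nonneg_left (hη.variance_le N)
      (integral_nonneg (μ := P) fun a => sq_nonneg (h N a))
    linarith

/-- The transform of a white noise by a predictable sequence which is bounded in `ℓ²` converges. -/
theorem ae_tendsto_transform_of_bdd (hh : ∀ n, Measurable[ℱ n] (h n))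
    (hη : IsScalarNoise P ℱ η σ) (hR : ∀ a N, ∑ n ∈ Finset.range N, h n a ^ 2 ≤ R) :
    ∀ᵐ a ∂P, ∃ l, Tendsto (fun N => ∑ n ∈ Finset.range N, h n a * η n a) atTop (𝓝 l) := by
  have hσ : 0 ≤ σ := (integral_nonneg fun a => sq_nonneg (η 0 a)).trans (hη.variance_le 0)
  have hc : ∀ n a, |h n a| ≤ √R := fun n a => Real.abs_le_sqrt <|
    (Finset.single_le_sum (f := fun n => h n a ^ 2) (fun i _ => sq_nonneg _)
      (Finset.self_mem_range_succ n)).trans (hR a (n + 1))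
  set M : ℕ → Ω → ℝ := fun N a => ∑ n ∈ Finset.range N, h n a * η n a with hM
  have hML : ∀ N, MemLp (M N) 2 P := memLp_transform hh hη hc
  have hMI : ∀ N, Integrable (M N) P := fun N => (hML N).integrable (by norm_num)
  have hmart : Martingale M ℱ P := by
    refine martingale_of_condExp_sub_eq_zero_nat
      (fun N => (measurable_transform hh hη N).stronglyMeasurable) hMI fun N => ?_
    have e : M (N + 1) - M N = h N * η N := by
      ext a
      simp [hM, Finset.sum_range_succ]
    have hI : Integrable (h N * η N) P := e ▸ (hMI (N + 1)).sub (hMI N)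
    rw [e]
    filter_upwards [condExp_mul_of_stronglyMeasurable_left (hh N).stronglyMeasurable hI
      ((hη.memLp N).integrable (by norm_num)),
      condExp_indep_eq (hη.measurable' N).comap_le (ℱ.le N)
        (comap_measurable (η N)).stronglyMeasurable (hη.indep N)] with a h1 h2
    rw [h1, Pi.mul_apply, h2, hη.mean_zero, mul_zero, Pi.zero_apply]
  -- The L¹ bound follows from the L² bound through `|t| ≤ 1 + t ^ 2`.
  refine hmart.submartingale.exists_ae_tendsto_of_bdd (R := (1 + σ * R).toNNReal) fun N => ?_
  rw [eLpNorm_one_eq_lintegral_enorm, ← ofReal_integral_norm_eq_lintegral_enorm (hMI N)]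
  refine ENNReal.ofReal_le_ofReal ?_
  calc ∫ a, ‖M N a‖ ∂P ≤ ∫ a, (1 + M N a ^ 2) ∂P := by
        refine integral_mono (hMI N).norm ((integrable_const _).add (hML N).integrable_sq) fun a => ?_
        simp only [Real.norm_eq_abs]
        nlinarith [sq_abs (M N a), sq_nonneg (|M N a| - 1)]
    _ = 1 + ∫ a, M N a ^ 2 ∂P := by
        rw [integral_add (integrable_const _) (hML N).integrable_sq]; simp
    _ ≤ 1 + σ * ∫ a, ∑ n ∈ Finset.range N, h n a ^ 2 ∂P := by
        gcongr; exact integral_sq_transform_le hh hη hc N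
    _ ≤ 1 + σ * R := by
        gcongr
        refine (integral_mono_of_nonneg (ae_of_all _ fun a => Finset.sum_nonneg fun i _ => sq_nonneg _)
          (integrable_const R) (ae_of_all _ fun a => hR a N)).trans ?_
        simp

/-- The transform of a white noise by a predictable sequence converges almost surely where the
predictable sequence is square summable. -/
theorem ae_tendsto_transform (hh : ∀ n, Measurable[ℱ n] (h n)) (hη : IsScalarNoise P ℱ η σ) :
    ∀ᵐ a ∂P, (∃ R : ℝ, ∀ N, ∑ n ∈ Finset.range N, h n a ^ 2 ≤ R) →
      ∃ l, Tendsto (fun N => ∑ n ∈ Finset.range N, h n a * η n a) atTop (𝓝 l) := by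
  classical
  -- Stopping at energy level `r`. The tested sum includes `h n`, so the energy of `g r` never
  -- exceeds `r`, and `g r` is still predictable because `h n` is `ℱ n`-measurable. On a path of
  -- finite energy, `g r` equals `h` for large `r`.
  let g : ℕ → ℕ → Ω → ℝ := fun r n a =>
    if ∑ k ∈ Finset.range (n + 1), h k a ^ 2 ≤ r then h n a else 0
  have hg : ∀ r n, Measurable[ℱ n] (g r n) := fun r n => by
    refine Measurable.ite ?_ (hh n) measurable_const
    refine measurableSet_le (Finset.measurable_fun_sum _ fun k hk => ?_) measurable_const
    exact ((hh k).mono (ℱ.mono (Nat.lt_succ_iff.1 (Finset.mem_range.1 hk))) le_rfl).pow_const 2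
  have hgR : ∀ (r : ℕ) a N, ∑ n ∈ Finset.range N, g r n a ^ 2 ≤ (r : ℝ) := by
    intro r a N
    induction N with
    | zero => simp
    | succ N ih =>
      by_cases hN : ∑ k ∈ Finset.range (N + 1), h k a ^ 2 ≤ r
      · refine (Finset.sum_le_sum fun n _ => ?_).trans hN
        by_cases hn : ∑ k ∈ Finset.range (n + 1), h k a ^ 2 ≤ r
        · simp [g, hn]
        · simp [g, hn, sq_nonneg]
      · rw [Finset.sum_range_succ]
        simpa [g, hN] using ih
  have := ae_all_iff.2 fun r : ℕ => ae_tendsto_transform_of_bdd (hg r) hη (hgR r)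
  filter_upwards [this] with a ha ⟨R, hR⟩
  obtain ⟨r, hr⟩ := exists_nat_ge R
  obtain ⟨l, hl⟩ := ha r
  refine ⟨l, hl.congr fun N => Finset.sum_congr rfl fun n _ => ?_⟩
  simp [g, (hR (n + 1)).trans hr]

/-- Law of large numbers for martingale differences `f n * η n`. -/
theorem ae_hasMean_mul_noise {f : ℕ → Ω → ℝ} (hf : ∀ n, Measurable[ℱ n] (f n))
    (hη : IsScalarNoise P ℱ η σ) :
    ∀ᵐ a ∂P, BddPower (fun n => f n a) → HasMean (fun n => f n a * η n a) 0 := by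
  filter_upwards [ae_tendsto_transform (h := fun n a => f n a / (n + 1))
    (fun n => (hf n).div_const _) hη] with a ha hbdd
  obtain ⟨l, hl⟩ := ha hbdd.exists_sum_div_sq_le
  exact HasMean.of_tendsto_sum_div (hl.congr fun N => Finset.sum_congr rfl fun n _ => by ring)

end MartingaleTransform

/-! ### Vector white noise and its correlation with linear systems. -/

section WhiteNoise

variable {Ω : Type*} {mΩ : MeasurableSpace Ω} {P : Measure Ω}
  {ℱ : Filtration ℕ mΩ} {ι κ ρ : Type*} [Fintype ι] [Fintype κ]
  {η : ℕ → Ω → κ → ℝ} {Q : Matrix κ κ ℝ} {c : ℝ}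

/-- A vector white noise with covariance matrix `Q`: `η n` is revealed at time `n + 1`, is
independent of the past `ℱ n`, centered, and has uniformly bounded fourth moments. -/
structure IsWhiteNoise (P : Measure Ω) (ℱ : Filtration ℕ mΩ) (η : ℕ → Ω → κ → ℝ)
    (Q : Matrix κ κ ℝ) (c : ℝ) : Prop where
  measurable : ∀ n, Measurable[ℱ (n + 1)] (η n)
  indep : ∀ n, Indep (MeasurableSpace.comap (η n) inferInstance) (ℱ n) P
  memLp : ∀ n i, MemLp (fun a => η n a i) 4 P
  mean_zero : ∀ n i, ∫ a, η n a i ∂P = 0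
  covariance : ∀ n i j, ∫ a, η n a i * η n a j ∂P = Q i j
  fourth_moment_le : ∀ n i, ∫ a, η n a i ^ 4 ∂P ≤ c

/-- The filtration `n ↦ ℱ (n + d)`. -/
def shiftFiltration (ℱ : Filtration ℕ mΩ) (d : ℕ) : Filtration ℕ mΩ where
  seq n := ℱ (n + d)
  mono' _ _ h := ℱ.mono (Nat.add_le_add_right h d)
  le' n := ℱ.le (n + d)

theorem IsScalarNoise.shift {η : ℕ → Ω → ℝ} {σ : ℝ} (hη : IsScalarNoise P ℱ η σ) (d : ℕ) :
    IsScalarNoise P (shiftFiltration ℱ d) (fun n => η (n + d)) σ where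
  measurable n := by
    have := hη.measurable (n + d)
    rwa [add_right_comm] at this
  indep n := hη.indep (n + d)
  memLp n := hη.memLp (n + d)
  mean_zero n := hη.mean_zero (n + d)
  variance_le n := hη.variance_le (n + d)

namespace IsWhiteNoise

variable [IsProbabilityMeasure P]

omit [Fintype κ] [IsProbabilityMeasure P] in
theorem measurable_coord (hη : IsWhiteNoise P ℱ η Q c) (n : ℕ) (i : κ) :
    Measurable[ℱ (n + 1)] (fun a => η n a i) :=
  (measurable_pi_apply i).comp (hη.measurable n)

omit [Fintype κ] in
theorem memLp_two (hη : IsWhiteNoise P ℱ η Q c) (n : ℕ) (i : κ) :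
    MemLp (fun a => η n a i) 2 P :=
  (hη.memLp n i).mono_exponent (by norm_num)

omit [Fintype κ] in
theorem isScalarNoise (hη : IsWhiteNoise P ℱ η Q c) (i : κ) :
    IsScalarNoise P ℱ (fun n a => η n a i) (Q i i) where
  measurable n := hη.measurable_coord n i
  indep n := indep_of_indep_of_le_left (hη.indep n)
    ((measurable_pi_apply i).comp (comap_measurable (η n))).comap_le
  memLp n := hη.memLp_two n i
  mean_zero n := hη.mean_zero n i
  variance_le n := by
    rw [← hη.covariance n i i]
    simp only [pow_two, le_refl]

omit [Fintype κ] in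
theorem isScalarNoise_mul (hη : IsWhiteNoise P ℱ η Q c) (i j : κ) :
    IsScalarNoise P ℱ (fun n a => η n a i * η n a j - Q i j) (2 * c + 2 * Q i j ^ 2) where
  measurable n := ((hη.measurable_coord n i).mul (hη.measurable_coord n j)).sub_const _
  indep n := indep_of_indep_of_le_left (hη.indep n)
    ((((measurable_pi_apply i).comp (comap_measurable (η n))).mul
      ((measurable_pi_apply j).comp (comap_measurable (η n)))).sub_const _).comap_le
  memLp n := by
    have : ENNReal.HolderTriple 4 4 2 := ⟨by
      rw [show (4 : ENNReal) = 2 * 2 by norm_num,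
        ENNReal.mul_inv (by norm_num) (by norm_num), ← mul_add, ENNReal.inv_two_add_inv_two,
        mul_one]⟩
    exact ((hη.memLp n j).mul (hη.memLp n i)).sub (memLp_const _)
  mean_zero n := by
    have hI := (hη.memLp_two n i).integrable_mul (hη.memLp_two n j)
    refine (integral_sub hI (integrable_const _)).trans ?_
    simp [hη.covariance n i j]
  variance_le n := by
    have h4 : ∀ i, Integrable (fun a => η n a i ^ 4) P := fun i => by
      have := (hη.memLp n i).integrable_norm_pow (by norm_num)
      refine this.congr (ae_of_all _ fun a => ?_)
      simp [(by decide : Even 4).pow_abs]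
    calc ∫ a, (η n a i * η n a j - Q i j) ^ 2 ∂P
        ≤ ∫ a, ((η n a i ^ 4 + η n a j ^ 4) + 2 * Q i j ^ 2) ∂P := by
          refine integral_mono_of_nonneg (ae_of_all _ fun a => sq_nonneg _)
            (((h4 i).add (h4 j)).add (integrable_const _)) (ae_of_all _ fun a => ?_)
          simp only
          -- This is `(x y - Q)² ≤ 2 x² y² + 2 Q²` followed by `2 x² y² ≤ x⁴ + y⁴`.
          nlinarith [sq_nonneg (η n a i * η n a j + Q i j),
            sq_nonneg (η n a i ^ 2 - η n a j ^ 2)]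
      _ = (∫ a, η n a i ^ 4 ∂P + ∫ a, η n a j ^ 4 ∂P) + 2 * Q i j ^ 2 := by
          have := integral_add ((h4 i).add (h4 j)) (integrable_const (μ := P) (2 * Q i j ^ 2))
          simp only [Pi.add_apply] at this
          rw [this, integral_add (h4 i) (h4 j)]
          simp
      _ ≤ _ := by linarith [hη.fourth_moment_le n i, hη.fourth_moment_le n j]

theorem ae_hasMean_mul (hη : IsWhiteNoise P ℱ η Q c) :
    ∀ᵐ a ∂P, ∀ i j, HasMean (fun n => η n a i * η n a j) (Q i j) := by
  refine ae_all_iff.2 fun i => ae_all_iff.2 fun j => ?_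
  filter_upwards [ae_hasMean_mul_noise (f := fun _ _ => 1) (fun _ => measurable_const)
    (hη.isScalarNoise_mul i j)] with a ha
  have := (ha ⟨1, by simp⟩).add (HasMean.const (Q i j))
  simpa using this

/-- Almost surely, the noise is empirically uncorrelated with each predictable sequence of bounded
average power. -/
theorem ae_hasMean_predictable_mul (hη : IsWhiteNoise P ℱ η Q c) {f : ℕ → Ω → ℝ}
    (hf : ∀ n, Measurable[ℱ n] (f n)) :
    ∀ᵐ a ∂P, BddPower (fun n => f n a) → ∀ j, HasMean (fun n => f n a * η n a j) 0 := by
  filter_upwards [ae_all_iff.2 fun j => ae_hasMean_mul_noise hf (hη.isScalarNoise j)]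
    with a ha hb j using ha j hb

omit [Fintype κ] [IsProbabilityMeasure P] in
theorem bddPower_of_hasMean {η : ℕ → κ → ℝ}
    (h : ∀ i j, HasMean (fun n => η n i * η n j) (Q i j)) (i : κ) : BddPower (fun n => η n i) :=
  ((h i i).congr fun _ => (pow_two _).symm).bddPower

omit [IsProbabilityMeasure P] in
theorem bddPower_dotProduct {η : ℕ → κ → ℝ} (h : ∀ i, BddPower (fun n => η n i)) (v : κ → ℝ) :
    BddPower (fun n => v ⬝ᵥ η n) :=
  BddPower.sum _ fun i _ => (h i).const_mul (v i)

omit [IsProbabilityMeasure P] in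
theorem hasMean_dotProduct_mul {η : ℕ → κ → ℝ} {b : ℕ → ℝ} {l : κ → ℝ}
    (h : ∀ i, HasMean (fun n => η n i * b n) (l i)) (v : κ → ℝ) :
    HasMean (fun n => (v ⬝ᵥ η n) * b n) (v ⬝ᵥ l) :=
  (HasMean.sum Finset.univ fun i _ => (h i).const_mul (v i)).congr fun n => by
    simp [dotProduct, Finset.sum_mul, mul_assoc]

/-- In the filtration shifted by `d + 1`, the earlier noise `η n` is already known and plays the
part of the predictable sequence. -/
theorem ae_hasMean_delayed (hη : IsWhiteNoise P ℱ η Q c) (d : ℕ) :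
    ∀ᵐ a ∂P, ∀ i j, HasMean (fun n => η (n + d + 1) a i * η n a j) 0 := by
  refine ae_all_iff.2 fun i => ae_all_iff.2 fun j => ?_
  have hs := (hη.isScalarNoise i).shift (d + 1)
  have hm : ∀ n, Measurable[shiftFiltration ℱ (d + 1) n] (fun a => η n a j) := fun n =>
    (hη.measurable_coord n j).mono (ℱ.mono (by omega)) le_rfl
  filter_upwards [hη.ae_hasMean_mul, ae_hasMean_mul_noise hm hs] with a h1 h2
  exact (h2 (bddPower_of_hasMean h1 j)).congr fun _ => mul_comm _ _

end IsWhiteNoise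

variable {S : ℕ → Ω → ι → ℝ} {F : Matrix ι ι ℝ} {G : Matrix ι κ ℝ}

theorem measurable_state {κ : Type*} [Fintype κ] {η : ℕ → Ω → κ → ℝ} {G : Matrix ι κ ℝ}
    (hη : ∀ n, Measurable[ℱ (n + 1)] (η n)) (hS₀ : Measurable[ℱ 0] (S 0))
    (hS : ∀ n a, S (n + 1) a = F *ᵥ S n a + G *ᵥ η n a) (n : ℕ) : Measurable[ℱ n] (S n) := by
  induction n with
  | zero => exact hS₀
  | succ n ih =>
    have e : S (n + 1) = fun a => F *ᵥ S n a + G *ᵥ η n a := funext (hS n)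
    rw [e]
    have h1 : Measurable (fun s : ι → ℝ => F *ᵥ s) :=
      (Continuous.matrix_mulVec continuous_const continuous_id).measurable
    have h2 : Measurable (fun s : κ → ℝ => G *ᵥ s) :=
      (Continuous.matrix_mulVec continuous_const continuous_id).measurable
    exact (h1.comp (ih.mono (ℱ.mono n.le_succ) le_rfl)).add (h2.comp (hη n))

variable [IsProbabilityMeasure P]

/-- The empirical correlation of a functional of the state of a linear system, stable or not, with
the past noise is the impulse response, as soon as the functional has bounded average power. -/
theorem ae_hasMean_state_mul_noise [DecidableEq ι] (hη : IsWhiteNoise P ℱ η Q c)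
    (hS₀ : Measurable[ℱ 0] (S 0))
    (hS : ∀ n a, S (n + 1) a = F *ᵥ S n a + G *ᵥ η n a) (k : ℕ) (h : ι → ℝ) :
    ∀ᵐ a ∂P, BddPower (fun n => h ⬝ᵥ S (n + k + 1) a) → ∀ j,
      HasMean (fun n => (h ⬝ᵥ S (n + k + 1) a) * η n a j) ((h ᵥ* (F ^ k * G * Q)) j) := by
  have hstep : ∀ (h : ι → ℝ) n a,
      h ⬝ᵥ S (n + 1) a = (h ᵥ* F) ⬝ᵥ S n a + (h ᵥ* G) ⬝ᵥ η n a := fun h n a => by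
    rw [hS, dotProduct_add, Matrix.dotProduct_mulVec, Matrix.dotProduct_mulVec]
  induction k generalizing h with
  | zero =>
    have hm : ∀ n, Measurable[ℱ n] (fun a => (h ᵥ* F) ⬝ᵥ S n a) := fun n =>
      Measurable.comp (g := fun s : ι → ℝ => (h ᵥ* F) ⬝ᵥ s)
        (Continuous.dotProduct continuous_const continuous_id).measurable
        (measurable_state hη.measurable hS₀ hS n)
    filter_upwards [hη.ae_hasMean_mul, hη.ae_hasMean_predictable_mul hm] with a h1 h2 hb j
    have hb1 := IsWhiteNoise.bddPower_dotProduct (IsWhiteNoise.bddPower_of_hasMean h1) (h ᵥ* G)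
    -- `F` may be unstable: the predictable part has bounded power only because the whole functional
    -- and its noise part do.
    have hb2 : BddPower (fun n => (h ᵥ* F) ⬝ᵥ S n a) := by
      have := hb.sub hb1
      simpa only [add_zero, hstep, add_sub_cancel_right] using this
    have h3 := IsWhiteNoise.hasMean_dotProduct_mul (fun i => h1 i j) (h ᵥ* G)
    have h4 := (h2 hb2 j).add h3
    rw [pow_zero, Matrix.one_mul, ← Matrix.vecMul_vecMul]
    rw [zero_add] at h4
    exact h4.congr fun n => by rw [add_zero, hstep, add_mul]
  | succ k ih =>
    -- Peel off one step of the dynamics: the functional becomes `h ᵥ* F`, and the fresh noise, `k +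
    -- 1` steps after `η n`, contributes zero.
    filter_upwards [hη.ae_hasMean_mul, hη.ae_hasMean_delayed k, ih (h ᵥ* F)] with a h1 h2 h3 hb j
    have hb1 := (IsWhiteNoise.bddPower_dotProduct (IsWhiteNoise.bddPower_of_hasMean h1)
      (h ᵥ* G)).shift (k + 1)
    have hb2 : BddPower (fun n => (h ᵥ* F) ⬝ᵥ S (n + k + 1) a) := by
      have := hb.sub hb1
      simpa only [← add_assoc, hstep _ (_ + _ + _), add_sub_cancel_right] using this
    have h4 := IsWhiteNoise.hasMean_dotProduct_mul (fun i => h2 i j) (h ᵥ* G)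
    have h5 := (h3 hb2 j).add h4
    rw [Matrix.vecMul_vecMul] at h5
    have e : F * (F ^ k * G * Q) = F ^ (k + 1) * G * Q := by
      rw [pow_succ']; simp only [Matrix.mul_assoc]
    have e0 : (h ᵥ* G) ⬝ᵥ (fun _ => (0 : ℝ)) = 0 := dotProduct_zero _
    rw [e, e0, add_zero] at h5
    exact h5.congr fun n => by rw [← add_assoc, hstep _ (_ + _ + _), add_mul]

/-- At a positive lag the feedthrough `D` only brings in noise later than `η n`, so it leaves no
trace in the limit. -/
theorem ae_hasMean_output_mul_noise [DecidableEq ι] [Fintype ρ] (hη : IsWhiteNoise P ℱ η Q c)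
    (hS₀ : Measurable[ℱ 0] (S 0))
    (hS : ∀ n a, S (n + 1) a = F *ᵥ S n a + G *ᵥ η n a) {r : ℕ → Ω → ρ → ℝ} {H : Matrix ρ ι ℝ}
    {D : Matrix ρ κ ℝ} (hr : ∀ n a, r n a = H *ᵥ S n a + D *ᵥ η n a) (k : ℕ) :
    ∀ᵐ a ∂P, (∀ i, BddPower (fun n => r n a i)) → ∀ i j,
      HasMean (fun n => r (n + k + 1) a i * η n a j) ((H * F ^ k * G * Q) i j) := by
  filter_upwards [ae_all_iff.2 fun i => ae_hasMean_state_mul_noise hη hS₀ hS k (H i),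
    hη.ae_hasMean_mul, hη.ae_hasMean_delayed k] with a h1 h2 h3 hb i j
  have e : ∀ n, r n a i = H i ⬝ᵥ S n a + D i ⬝ᵥ η n a := fun n => by rw [hr]; rfl
  have hb1 := IsWhiteNoise.bddPower_dotProduct (IsWhiteNoise.bddPower_of_hasMean h2) (D i)
  have hb2 : BddPower (fun n => H i ⬝ᵥ S n a) := by
    simpa only [e, add_sub_cancel_right] using (hb i).sub hb1
  have h4 := (h1 i (by simpa only [add_assoc] using hb2.shift (k + 1)) j).add
    (IsWhiteNoise.hasMean_dotProduct_mul (fun i => h3 i j) (D i))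
  have e0 : D i ⬝ᵥ (fun _ => (0 : ℝ)) = 0 := dotProduct_zero _
  rw [e0, add_zero] at h4
  have e1 : (H i ᵥ* (F ^ k * G * Q)) j = (H * F ^ k * G * Q) i j := by
    simp only [Matrix.mul_assoc]; rfl
  rw [e1] at h4
  exact h4.congr fun n => by rw [e, add_mul]

end WhiteNoise

/-! ### Stable matrices, contracting norms and the Stein equation. -/

section Stability

variable {ι κ : Type*} [Fintype ι] [DecidableEq ι]

open scoped Matrix.Norms.Operator in
/-- Gelfand's formula: the powers of a matrix whose eigenvalues lie in the open unit disc tend to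
zero. -/
theorem tendsto_pow_of_spectrum_lt_one (M : Matrix ι ι ℝ)
    (h : ∀ μ ∈ spectrum ℂ (M.map (fun t : ℝ => (t : ℂ))), ‖μ‖ < 1) :
    Tendsto (fun n : ℕ => M ^ n) atTop (𝓝 0) := by
  rcases isEmpty_or_nonempty ι with hι | hι
  · exact tendsto_const_nhds.congr fun n => Subsingleton.elim _ _
  set M' : Matrix ι ι ℂ := M.map (fun t : ℝ => (t : ℂ)) with hM'
  have h1 : spectralRadius ℂ M' < (1 : NNReal) :=
    spectrum.spectralRadius_lt_of_forall_lt M' fun z hz => h z hz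
  obtain ⟨r, hr1, hr2⟩ := ENNReal.lt_iff_exists_nnreal_btwn.1 h1
  have hr2' : r < 1 := by exact_mod_cast hr2
  have h2 := (spectrum.pow_nnnorm_pow_one_div_tendsto_nhds_spectralRadius M').eventually
    (gt_mem_nhds hr1)
  have h3 : Tendsto (fun n : ℕ => M' ^ n) atTop (𝓝 0) := by
    refine squeeze_zero_norm' (a := fun n : ℕ => (r : ℝ) ^ n) ?_
      (tendsto_pow_atTop_nhds_zero_of_lt_one r.2 hr2')
    filter_upwards [h2, eventually_gt_atTop 0] with n hn hn0
    have h4 : (‖M' ^ n‖₊ : ENNReal) ≤ (r : ENNReal) ^ n := by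
      have := ENNReal.rpow_le_rpow hn.le (n.cast_nonneg : (0 : ℝ) ≤ n)
      rwa [← ENNReal.rpow_mul, one_div, inv_mul_cancel₀ (by positivity), ENNReal.rpow_one,
        ENNReal.rpow_natCast] at this
    exact_mod_cast h4
  have h5 : Tendsto (fun n : ℕ => (M' ^ n).map Complex.re) atTop (𝓝 ((0 : Matrix ι ι ℂ).map
      Complex.re)) :=
    ((Continuous.matrix_map continuous_id Complex.continuous_re).tendsto _).comp h3
  have e0 : (0 : Matrix ι ι ℂ).map Complex.re = 0 := by ext; simp
  rw [e0] at h5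
  refine h5.congr fun n => ?_
  have e1 : M' ^ n = (M ^ n).map (fun t : ℝ => (t : ℂ)) :=
    (map_pow (Complex.ofRealHom.mapMatrix (m := ι)) M n).symm
  rw [e1]
  ext i j
  simp

theorem spectrum_lt_one_fromBlocks [Fintype κ] [DecidableEq κ] {M₁ : Matrix ι ι ℝ}
    {M₂ : Matrix κ κ ℝ} (N : Matrix ι κ ℝ)
    (h₁ : ∀ μ ∈ spectrum ℂ (M₁.map (fun t : ℝ => (t : ℂ))), ‖μ‖ < 1)
    (h₂ : ∀ μ ∈ spectrum ℂ (M₂.map (fun t : ℝ => (t : ℂ))), ‖μ‖ < 1) :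
    ∀ μ ∈ spectrum ℂ ((Matrix.fromBlocks M₁ N 0 M₂).map (fun t : ℝ => (t : ℂ))), ‖μ‖ < 1 := by
  intro μ hμ
  have e : (0 : Matrix κ ι ℝ).map (fun t : ℝ => (t : ℂ)) = 0 := by ext; simp
  rw [Matrix.fromBlocks_map, e, Matrix.mem_spectrum_iff_isRoot_charpoly,
    Matrix.charpoly_fromBlocks_zero₂₁, Polynomial.root_mul] at hμ
  rcases hμ with hμ | hμ
  · exact h₁ μ (Matrix.mem_spectrum_iff_isRoot_charpoly.2 hμ)
  · exact h₂ μ (Matrix.mem_spectrum_iff_isRoot_charpoly.2 hμ)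

variable {F : Matrix ι ι ℝ}

open scoped Matrix.Norms.Operator in
/-- A stable matrix is a strict contraction for an equivalent norm. -/
theorem exists_contracting_norm (hF : Tendsto (fun n : ℕ => F ^ n) atTop (𝓝 0)) :
    ∃ (ρ c : ℝ) (N : (ι → ℝ) → ℝ), 0 ≤ ρ ∧ ρ < 1 ∧ 0 ≤ c ∧ (∀ v, N (F *ᵥ v) ≤ ρ * N v) ∧
      (∀ u v, N (u + v) ≤ N u + N v) ∧ (∀ v, ‖v‖ ≤ N v) ∧ ∀ v, N v ≤ c * ‖v‖ := by
  obtain ⟨k, hk, hk0⟩ : ∃ k : ℕ, ‖F ^ k‖ < 1 / 2 ∧ 0 < k := by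
    have h1 : Tendsto (fun n : ℕ => ‖F ^ n‖) atTop (𝓝 0) := tendsto_zero_iff_norm_tendsto_zero.1 hF
    exact ((h1.eventually (gt_mem_nhds (by norm_num : (0 : ℝ) < 1 / 2))).and
      (eventually_gt_atTop 0)).exists
  have hk1 : (1 : ℝ) ≤ k := by exact_mod_cast hk0
  -- Bernoulli's inequality gives `ρ ^ k ≥ 1 / 2`, which dominates `‖F ^ k‖`.
  set ρ : ℝ := 1 - 1 / (2 * k) with hρ
  have hρ0 : 0 < ρ := by
    rw [hρ, sub_pos, div_lt_one (by positivity)]; linarith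
  have hρ1 : ρ < 1 := by
    have : 0 < 1 / (2 * (k : ℝ)) := by positivity
    linarith
  have hρk : 1 / 2 ≤ ρ ^ k := by
    have := one_add_mul_le_pow (a := -(1 / (2 * (k : ℝ)))) (by
      have : 1 / (2 * (k : ℝ)) ≤ 1 := by rw [div_le_one (by positivity)]; linarith
      linarith) k
    refine le_trans (le_of_eq ?_) this
    field_simp
    norm_num
  -- Applying `F` shifts this weighted sum along the orbit. The new last term is at most `‖v‖`, the
  -- first term that is lost, so the sum shrinks by the factor `ρ`.
  refine ⟨ρ, ∑ j ∈ Finset.range k, ρ⁻¹ ^ j * ‖F ^ j‖,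
    fun v => ∑ j ∈ Finset.range k, ρ⁻¹ ^ j * ‖(F ^ j) *ᵥ v‖, hρ0.le, hρ1,
    Finset.sum_nonneg fun j _ => by positivity, fun v => ?_, fun u v => ?_, fun v => ?_,
    fun v => ?_⟩
  · have h1 := Finset.sum_range_succ (fun j => ρ⁻¹ ^ j * ‖(F ^ j) *ᵥ v‖) k
    rw [Finset.sum_range_succ', pow_zero, pow_zero, Matrix.one_mulVec, one_mul] at h1
    have h2 : ρ⁻¹ ^ k * ‖(F ^ k) *ᵥ v‖ ≤ ‖v‖ := by
      have h3 : ‖(F ^ k) *ᵥ v‖ ≤ 1 / 2 * ‖v‖ :=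
        (Matrix.linfty_opNorm_mulVec _ _).trans (by gcongr)
      rw [inv_pow, inv_mul_le_iff₀ (by positivity)]
      exact h3.trans (by gcongr)
    have h4 : ∑ j ∈ Finset.range k, ρ⁻¹ ^ j * ‖(F ^ j) *ᵥ (F *ᵥ v)‖ =
        ρ * ∑ j ∈ Finset.range k, ρ⁻¹ ^ (j + 1) * ‖(F ^ (j + 1)) *ᵥ v‖ := by
      rw [Finset.mul_sum]
      refine Finset.sum_congr rfl fun j _ => ?_
      rw [Matrix.mulVec_mulVec, ← pow_succ, pow_succ ρ⁻¹]
      field_simp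
    refine h4.le.trans ?_
    exact mul_le_mul_of_nonneg_left (by linarith) hρ0.le
  · rw [← Finset.sum_add_distrib]
    refine Finset.sum_le_sum fun j _ => ?_
    rw [Matrix.mulVec_add, ← mul_add]
    gcongr
    exact norm_add_le _ _
  · have := Finset.single_le_sum (f := fun j => ρ⁻¹ ^ j * ‖(F ^ j) *ᵥ v‖)
      (fun j _ => by positivity) (Finset.mem_range.2 hk0)
    simpa using this
  · rw [Finset.sum_mul]
    refine Finset.sum_le_sum fun j _ => ?_
    rw [mul_assoc]
    gcongr
    exact Matrix.linfty_opNorm_mulVec _ _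

/-- The Stein operator `X ↦ X - F X Fᵀ`. -/
def steinMap (F : Matrix ι ι ℝ) : Matrix ι ι ℝ →ₗ[ℝ] Matrix ι ι ℝ where
  toFun X := X - F * X * Fᵀ
  map_add' X Y := by simp only [Matrix.mul_add, Matrix.add_mul]; abel
  map_smul' r X := by simp [smul_sub]

theorem tendsto_pow_mul_mul_pow (hF : Tendsto (fun n : ℕ => F ^ n) atTop (𝓝 0))
    (X : Matrix ι ι ℝ) : Tendsto (fun n : ℕ => F ^ n * X * (F ^ n)ᵀ) atTop (𝓝 0) := by
  have h1 : Continuous fun Y : Matrix ι ι ℝ => Y * X * Yᵀ := by fun_prop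
  have h2 := (h1.tendsto 0).comp hF
  simp only [Matrix.zero_mul] at h2
  exact h2

theorem eq_sum_add_of_stein {X Y : Matrix ι ι ℝ} (h : X = F * X * Fᵀ + Y) (n : ℕ) :
    X = F ^ n * X * (F ^ n)ᵀ + ∑ k ∈ Finset.range n, F ^ k * Y * (F ^ k)ᵀ := by
  induction n with
  | zero => simp
  | succ n ih =>
    have e : F ^ n * X * (F ^ n)ᵀ =
        F ^ (n + 1) * X * (F ^ (n + 1))ᵀ + F ^ n * Y * (F ^ n)ᵀ := by
      conv_lhs => rw [h]
      rw [pow_succ, Matrix.transpose_mul]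
      simp only [Matrix.mul_add, Matrix.add_mul, Matrix.mul_assoc]
    rw [Finset.sum_range_succ, add_comm (∑ k ∈ Finset.range n, _), ← add_assoc, ← e, ← ih]

theorem tendsto_sum_of_stein (hF : Tendsto (fun n : ℕ => F ^ n) atTop (𝓝 0))
    {X Y : Matrix ι ι ℝ} (h : X = F * X * Fᵀ + Y) :
    Tendsto (fun n => ∑ k ∈ Finset.range n, F ^ k * Y * (F ^ k)ᵀ) atTop (𝓝 X) := by
  have h1 := (tendsto_const_nhds (x := X)).sub (tendsto_pow_mul_mul_pow hF X)
  rw [sub_zero] at h1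
  refine h1.congr fun n => ?_
  exact sub_eq_iff_eq_add'.2 (eq_sum_add_of_stein h n)

theorem steinMap_injective (hF : Tendsto (fun n : ℕ => F ^ n) atTop (𝓝 0)) :
    Function.Injective (steinMap F) := by
  rw [injective_iff_map_eq_zero]
  intro X hX
  have h : X = F * X * Fᵀ + 0 := by rw [add_zero]; exact sub_eq_zero.1 hX
  exact tendsto_nhds_unique (tendsto_sum_of_stein hF h) (by simp)

theorem exists_stein (hF : Tendsto (fun n : ℕ => F ^ n) atTop (𝓝 0)) (Y : Matrix ι ι ℝ) :
    ∃ X : Matrix ι ι ℝ, X = F * X * Fᵀ + Y := by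
  obtain ⟨X, hX⟩ := (LinearMap.injective_iff_surjective.1 (steinMap_injective hF)) Y
  exact ⟨X, by rw [add_comm]; exact sub_eq_iff_eq_add.1 hX⟩

/-- In finite dimension the injective Stein operator has a continuous inverse. It thus suffices to
follow the image of an empirical covariance, which telescopes. -/
theorem tendsto_of_tendsto_steinMap (hF : Tendsto (fun n : ℕ => F ^ n) atTop (𝓝 0))
    {X : ℕ → Matrix ι ι ℝ} {L : Matrix ι ι ℝ}
    (h : Tendsto (fun n => steinMap F (X n)) atTop (𝓝 (steinMap F L))) :
    Tendsto X atTop (𝓝 L) := by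
  let e := LinearEquiv.ofInjectiveEndo (steinMap F) (steinMap_injective hF)
  have hc : Continuous e.symm.toLinearMap := LinearMap.continuous_of_finiteDimensional _
  have h1 := (hc.tendsto _).comp h
  have e1 : ∀ Y, e.symm (steinMap F Y) = Y := fun Y => e.symm_apply_apply Y
  simpa [Function.comp_def, e1] using h1

end Stability

/-! ### Growth of the states of a stable recursion. -/

section StableRecursion

theorem tendsto_zero_of_le_mul_add {t ε : ℕ → ℝ} {ρ : ℝ} (hρ0 : 0 ≤ ρ) (hρ1 : ρ < 1)
    (ht0 : ∀ n, 0 ≤ t n) (ht : ∀ n, t (n + 1) ≤ ρ * t n + ε n) (hε : Tendsto ε atTop (𝓝 0)) :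
    Tendsto t atTop (𝓝 0) := by
  rw [Metric.tendsto_atTop]
  intro δ hδ
  obtain ⟨n₀, hn₀⟩ := eventually_atTop.1
    (hε.eventually (gt_mem_nhds (by nlinarith : 0 < (1 - ρ) * (δ / 2))))
  have h1 : ∀ m, t (n₀ + m) ≤ ρ ^ m * t n₀ + δ / 2 := by
    intro m
    induction m with
    | zero => simp; linarith
    | succ m ih =>
      have h2 := ht (n₀ + m)
      have h3 := hn₀ (n₀ + m) (Nat.le_add_right _ _)
      have h4 := mul_le_mul_of_nonneg_left ih hρ0
      rw [← add_assoc, pow_succ']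
      linarith
  obtain ⟨m₀, hm₀⟩ := eventually_atTop.1
    (((tendsto_pow_atTop_nhds_zero_of_lt_one hρ0 hρ1).mul_const (t n₀)).eventually
      (gt_mem_nhds (by simpa using hδ : 0 * t n₀ < δ / 2)))
  refine ⟨n₀ + m₀, fun n hn => ?_⟩
  obtain ⟨m, rfl⟩ := Nat.exists_eq_add_of_le hn
  rw [Real.dist_0_eq_abs, abs_of_nonneg (ht0 _), add_assoc]
  have := hm₀ (m₀ + m) (Nat.le_add_right _ _)
  linarith [h1 (m₀ + m)]

theorem BddPower.of_le_mul_add {b a : ℕ → ℝ} {ρ : ℝ} (hρ0 : 0 ≤ ρ) (hρ1 : ρ < 1)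
    (hb0 : ∀ n, 0 ≤ b n) (hb : ∀ n, b (n + 1) ≤ ρ * b n + a n) (ha : BddPower a) :
    BddPower b := by
  obtain ⟨c, hc⟩ := ha
  have hρ : 0 < 1 - ρ := by linarith
  have hstep : ∀ n, b (n + 1) ^ 2 ≤ ρ * b n ^ 2 + a n ^ 2 / (1 - ρ) := fun n => by
    have h1 : b (n + 1) ^ 2 ≤ (ρ * b n + a n) ^ 2 := pow_le_pow_left₀ (hb0 _) (hb n) 2
    refine h1.trans ?_
    rw [← sub_nonneg]
    -- Completing the square makes the recursion for `b` a linear recursion for its energy.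
    have : ρ * b n ^ 2 + a n ^ 2 / (1 - ρ) - (ρ * b n + a n) ^ 2 =
        ρ * ((1 - ρ) * b n - a n) ^ 2 / (1 - ρ) := by
      field_simp; ring
    rw [this]
    positivity
  have hsum : ∀ N : ℕ, (1 - ρ) * ∑ n ∈ Finset.range N, b n ^ 2 + b N ^ 2 ≤
      b 0 ^ 2 + (∑ n ∈ Finset.range N, a n ^ 2) / (1 - ρ) := by
    intro N
    induction N with
    | zero => simp
    | succ N ih =>
      rw [Finset.sum_range_succ, Finset.sum_range_succ, mul_add, add_div]
      linarith [hstep N]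
  refine ⟨(b 0 ^ 2 + c / (1 - ρ)) / (1 - ρ), fun N => ?_⟩
  rcases N.eq_zero_or_pos with rfl | hN
  · simp
  have hN1 : (1 : ℝ) ≤ N := by exact_mod_cast hN
  rw [div_mul_eq_mul_div, le_div_iff₀ hρ, mul_comm]
  have h2 : (∑ n ∈ Finset.range N, a n ^ 2) / (1 - ρ) ≤ c / (1 - ρ) * N := by
    rw [div_mul_eq_mul_div]
    gcongr
    exact hc N
  nlinarith [hsum N, sq_nonneg (b N), sq_nonneg (b 0)]

variable {ι : Type*} [Fintype ι] {F : Matrix ι ι ℝ} {s g : ℕ → ι → ℝ}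

theorem norm_le_sum_abs (v : ι → ℝ) : ‖v‖ ≤ ∑ i, |v i| := by
  refine (pi_norm_le_iff_of_nonneg (Finset.sum_nonneg fun i _ => abs_nonneg _)).2 fun i => ?_
  exact Finset.single_le_sum (f := fun i => |v i|) (fun i _ => abs_nonneg _) (Finset.mem_univ i)

variable [DecidableEq ι]

/-- Bounded-power inputs of a stable system produce states of bounded power. -/
theorem BddPower.of_stable (hF : Tendsto (fun n : ℕ => F ^ n) atTop (𝓝 0))
    (hs : ∀ n, s (n + 1) = F *ᵥ s n + g n) (hg : ∀ i, BddPower (fun n => g n i)) (i : ι) :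
    BddPower (fun n => s n i) := by
  obtain ⟨ρ, c, N, hρ0, hρ1, hc, hN1, hN2, hN3, hN4⟩ := exists_contracting_norm hF
  have hN0 : ∀ v, 0 ≤ N v := fun v => (norm_nonneg v).trans (hN3 v)
  have hb : BddPower (fun n => N (s n)) := by
    refine BddPower.of_le_mul_add hρ0 hρ1 (fun n => hN0 _) (a := fun n => c * ∑ i, |g n i|)
      (fun n => ?_) ((BddPower.sum _ fun i _ => (hg i).mono fun n => (abs_abs _).le).const_mul c)
    rw [hs]
    refine (hN2 _ _).trans (add_le_add (hN1 _) ((hN4 _).trans ?_))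
    exact mul_le_mul_of_nonneg_left (norm_le_sum_abs _) hc
  refine hb.mono fun n => ?_
  rw [abs_of_nonneg (hN0 _)]
  exact (norm_le_pi_norm (s n) i).trans (hN3 _)

/-- Bounded power alone gives `O(√n)`. The boundary term of the telescoped covariance needs `o(√n)`.
-/
theorem tendsto_div_sqrt_of_stable (hF : Tendsto (fun n : ℕ => F ^ n) atTop (𝓝 0))
    (hs : ∀ n, s (n + 1) = F *ᵥ s n + g n)
    (hg : ∀ i, Tendsto (fun n : ℕ => g n i / √(n + 1)) atTop (𝓝 0)) (i : ι) :
    Tendsto (fun n : ℕ => s n i / √(n + 1)) atTop (𝓝 0) := by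
  obtain ⟨ρ, c, N, hρ0, hρ1, hc, hN1, hN2, hN3, hN4⟩ := exists_contracting_norm hF
  have hN0 : ∀ v, 0 ≤ N v := fun v => (norm_nonneg v).trans (hN3 v)
  have hb : Tendsto (fun n : ℕ => N (s n) / √(n + 1)) atTop (𝓝 0) := by
    refine tendsto_zero_of_le_mul_add hρ0 hρ1 (fun n => div_nonneg (hN0 _) (Real.sqrt_nonneg _))
      (ε := fun n => c * ∑ i, |g n i / √(n + 1)|) (fun n => ?_) ?_
    · have h1 : N (s (n + 1)) ≤ ρ * N (s n) + c * ∑ i, |g n i| := by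
        rw [hs]
        refine (hN2 _ _).trans (add_le_add (hN1 _) ((hN4 _).trans ?_))
        exact mul_le_mul_of_nonneg_left (norm_le_sum_abs _) hc
      have h2 : N (s (n + 1)) / √((n + 1 : ℕ) + 1) ≤
          (ρ * N (s n) + c * ∑ i, |g n i|) / √(n + 1) := by
        refine div_le_div₀ ((hN0 _).trans h1) h1 (by positivity) (Real.sqrt_le_sqrt ?_)
        push_cast; linarith
      refine h2.trans (le_of_eq ?_)
      simp only [abs_div, abs_of_nonneg (Real.sqrt_nonneg _), ← Finset.sum_div]
      ring
    · have := (tendsto_finsetSum Finset.univ fun i _ => (hg i).abs).const_mul c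
      simpa using this
  refine squeeze_zero_norm (fun n => ?_) hb
  rw [norm_div, Real.norm_of_nonneg (Real.sqrt_nonneg _)]
  gcongr
  exact (norm_le_pi_norm (s n) i).trans (hN3 _)

theorem HasMean.tendsto_div_sqrt {a : ℕ → ℝ} {k : ℝ} (h : HasMean (fun n => a n ^ 2) k) :
    Tendsto (fun n : ℕ => a n / √(n + 1)) atTop (𝓝 0) := by
  have h1 := h.tendsto_div.sqrt
  rw [Real.sqrt_zero] at h1
  refine squeeze_zero_norm (fun n => le_of_eq ?_) h1
  rw [norm_div, Real.norm_of_nonneg (Real.sqrt_nonneg _), Real.sqrt_div' _ (by positivity),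
    Real.sqrt_sq_eq_abs, Real.norm_eq_abs]

end StableRecursion

/-! ### Empirical covariance matrices. -/

section MatrixMean

/-- The time averages of the sequence `a` of matrices converge to `L`. -/
def HasMatMean {ρ τ : Type*} (a : ℕ → Matrix ρ τ ℝ) (L : Matrix ρ τ ℝ) : Prop :=
  Tendsto (fun N : ℕ => (1 / (N : ℝ)) • ∑ n ∈ Finset.range N, a n) atTop (𝓝 L)

variable {ι κ ρ τ υ : Type*}

theorem tendsto_vecMulVec_div {s : ℕ → ι → ℝ}
    (h : ∀ i, Tendsto (fun n : ℕ => s n i / √(n + 1)) atTop (𝓝 0)) :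
    Tendsto (fun N : ℕ => (1 / (N : ℝ)) • Matrix.vecMulVec (s N) (s N)) atTop (𝓝 0) := by
  refine tendsto_pi_nhds.2 fun i => tendsto_pi_nhds.2 fun j => ?_
  have h0 : Tendsto (fun N : ℕ => ((N : ℝ) + 1) / N) atTop (𝓝 1) := by
    have := (tendsto_natCast_div_add_atTop (1 : ℝ)).inv₀ one_ne_zero
    simpa only [inv_div, inv_one] using this
  have h1 := h0.mul ((h i).mul (h j))
  simp only [mul_zero] at h1
  refine h1.congr' ?_
  filter_upwards [eventually_gt_atTop 0] with N hN
  have : (N : ℝ) ≠ 0 := by positivity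
  have h2 : √((N : ℝ) + 1) * √((N : ℝ) + 1) = N + 1 := Real.mul_self_sqrt (by positivity)
  rw [div_mul_div_comm, h2]
  simp only [Matrix.smul_apply, Matrix.vecMulVec_apply, smul_eq_mul]
  field_simp

variable [Fintype ι] [Fintype κ]

theorem hasMatMean_iff {a : ℕ → Matrix ρ τ ℝ} {L : Matrix ρ τ ℝ} :
    HasMatMean a L ↔ ∀ i j, HasMean (fun n => a n i j) (L i j) := by
  refine tendsto_pi_nhds.trans (forall_congr' fun i => tendsto_pi_nhds.trans
    (forall_congr' fun j => ?_))
  simp [HasMean, Matrix.sum_apply]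

namespace HasMatMean

variable {a b : ℕ → Matrix ρ τ ℝ} {L M : Matrix ρ τ ℝ}

theorem add (ha : HasMatMean a L) (hb : HasMatMean b M) :
    HasMatMean (fun n => a n + b n) (L + M) := by
  rw [hasMatMean_iff] at *
  exact fun i j => (ha i j).add (hb i j)

theorem mul_left [Fintype ρ] (ha : HasMatMean a L) (U : Matrix υ ρ ℝ) :
    HasMatMean (fun n => U * a n) (U * L) := by
  rw [hasMatMean_iff] at *
  intro i j
  exact HasMean.sum Finset.univ fun k _ => (ha k j).const_mul (U i k)

theorem transpose (ha : HasMatMean a L) : HasMatMean (fun n => (a n)ᵀ) Lᵀ := by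
  rw [hasMatMean_iff] at *
  exact fun i j => ha j i

theorem mul_right [Fintype τ] (ha : HasMatMean a L) (U : Matrix τ υ ℝ) :
    HasMatMean (fun n => a n * U) (L * U) := by
  have := (ha.transpose.mul_left Uᵀ).transpose
  simpa only [Matrix.transpose_mul, Matrix.transpose_transpose] using this

theorem unique (h : HasMatMean a L) (h' : HasMatMean a M) : L = M :=
  tendsto_nhds_unique h h'

end HasMatMean

variable {s : ℕ → ι → ℝ} {η : ℕ → κ → ℝ} {Q : Matrix κ κ ℝ} {X : Matrix ι ι ℝ}

theorem vecMulVec_add_mulVec (U : Matrix ρ ι ℝ) (V : Matrix ρ κ ℝ) (x : ι → ℝ) (y : κ → ℝ) :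
    Matrix.vecMulVec (U *ᵥ x + V *ᵥ y) (U *ᵥ x + V *ᵥ y) =
      U * Matrix.vecMulVec x x * Uᵀ + (V * (Matrix.vecMulVec x y)ᵀ * Uᵀ +
        U * Matrix.vecMulVec x y * Vᵀ + V * Matrix.vecMulVec y y * Vᵀ) := by
  simp only [Matrix.vecMulVec_add, Matrix.add_vecMulVec, Matrix.mul_vecMulVec,
    Matrix.vecMulVec_mul, Matrix.vecMul_transpose, Matrix.transpose_vecMulVec]
  abel

theorem hasMatMean_cross (hη : HasMatMean (fun n => Matrix.vecMulVec (η n) (η n)) Q)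
    (hsη : HasMatMean (fun n => Matrix.vecMulVec (s n) (η n)) 0)
    (U : Matrix ρ ι ℝ) (V : Matrix ρ κ ℝ) :
    HasMatMean (fun n => V * (Matrix.vecMulVec (s n) (η n))ᵀ * Uᵀ +
        U * Matrix.vecMulVec (s n) (η n) * Vᵀ + V * Matrix.vecMulVec (η n) (η n) * Vᵀ)
      (V * Q * Vᵀ) := by
  have := (((hsη.transpose.mul_left V).mul_right Uᵀ).add ((hsη.mul_left U).mul_right Vᵀ)).add
    ((hη.mul_left V).mul_right Vᵀ)
  simpa using this

theorem hasMatMean_output (hη : HasMatMean (fun n => Matrix.vecMulVec (η n) (η n)) Q)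
    (hsη : HasMatMean (fun n => Matrix.vecMulVec (s n) (η n)) 0)
    (hs : HasMatMean (fun n => Matrix.vecMulVec (s n) (s n)) X)
    (U : Matrix ρ ι ℝ) (V : Matrix ρ κ ℝ) :
    HasMatMean (fun n => Matrix.vecMulVec (U *ᵥ s n + V *ᵥ η n) (U *ᵥ s n + V *ᵥ η n))
      (U * X * Uᵀ + V * Q * Vᵀ) := by
  simp only [vecMulVec_add_mulVec]
  exact ((hs.mul_left U).mul_right Uᵀ).add (hasMatMean_cross hη hsη U V)

variable [DecidableEq ι] {F : Matrix ι ι ℝ} {G : Matrix ι κ ℝ}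

/-- The empirical covariance of the state of a stable system driven by a noise with which the state
is empirically uncorrelated converges to the solution of the Lyapunov equation. -/
theorem hasMatMean_state (hF : Tendsto (fun n : ℕ => F ^ n) atTop (𝓝 0))
    (hs : ∀ n, s (n + 1) = F *ᵥ s n + G *ᵥ η n)
    (hη : HasMatMean (fun n => Matrix.vecMulVec (η n) (η n)) Q)
    (hsη : HasMatMean (fun n => Matrix.vecMulVec (s n) (η n)) 0)
    (hlim : ∀ i, Tendsto (fun n : ℕ => s n i / √(n + 1)) atTop (𝓝 0))
    (hX : X = F * X * Fᵀ + G * Q * Gᵀ) :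
    HasMatMean (fun n => Matrix.vecMulVec (s n) (s n)) X := by
  -- The Stein operator sends the empirical covariance to the average of the terms containing noise,
  -- minus the boundary difference of the `N`-th and initial outer products over `N`. The two zeros
  -- in `e` are the boundary limits.
  refine tendsto_of_tendsto_steinMap hF ?_
  have e : steinMap F X = G * Q * Gᵀ - (0 - 0) := by
    rw [sub_zero, sub_zero]
    exact sub_eq_iff_eq_add'.2 hX
  have h0 : Tendsto (fun N : ℕ => (1 / (N : ℝ)) • Matrix.vecMulVec (s 0) (s 0)) atTop (𝓝 0) := by
    have := tendsto_one_div_atTop_nhds_zero_nat (𝕜 := ℝ).smul_const (Matrix.vecMulVec (s 0) (s 0))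
    rwa [zero_smul] at this
  rw [e]
  refine ((hasMatMean_cross hη hsη F G).sub ((tendsto_vecMulVec_div hlim).sub h0)).congr
    fun N => ?_
  have h1 : ∑ n ∈ Finset.range N, Matrix.vecMulVec (s (n + 1)) (s (n + 1)) =
      F * (∑ n ∈ Finset.range N, Matrix.vecMulVec (s n) (s n)) * Fᵀ +
        ∑ n ∈ Finset.range N, (G * (Matrix.vecMulVec (s n) (η n))ᵀ * Fᵀ +
          F * Matrix.vecMulVec (s n) (η n) * Gᵀ + G * Matrix.vecMulVec (η n) (η n) * Gᵀ) := by
    rw [Matrix.mul_sum, Matrix.sum_mul, ← Finset.sum_add_distrib]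
    exact Finset.sum_congr rfl fun n _ => by rw [hs, vecMulVec_add_mulVec]
  have h2 := Finset.sum_range_sub (fun n => Matrix.vecMulVec (s n) (s n)) N
  rw [Finset.sum_sub_distrib, h1] at h2
  change _ = _ - F * _ * Fᵀ
  rw [Matrix.mul_smul, Matrix.smul_mul, ← smul_sub, ← smul_sub, ← smul_sub, ← h2]
  congr 1
  abel

end MatrixMean

/-! ### Output covariance of a stable system. -/

section StableOutput

variable {Ω : Type*} {mΩ : MeasurableSpace Ω} {P : Measure Ω} [IsProbabilityMeasure P]
  {ℱ : Filtration ℕ mΩ} {ι κ ρ : Type*} [Fintype ι] [Fintype κ] [DecidableEq ι]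
  {η : ℕ → Ω → κ → ℝ} {Q : Matrix κ κ ℝ} {c : ℝ} {S : ℕ → Ω → ι → ℝ} {F : Matrix ι ι ℝ}
  {G : Matrix ι κ ℝ} {X : Matrix ι ι ℝ} {r : ℕ → Ω → ρ → ℝ} {H : Matrix ρ ι ℝ} {D : Matrix ρ κ ℝ}

/-- The empirical covariance of the output of a stable linear system driven by white noise. -/
theorem ae_hasMatMean_output (hη : IsWhiteNoise P ℱ η Q c) (hS₀ : Measurable[ℱ 0] (S 0))
    (hF : Tendsto (fun n : ℕ => F ^ n) atTop (𝓝 0))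
    (hS : ∀ n a, S (n + 1) a = F *ᵥ S n a + G *ᵥ η n a)
    (hr : ∀ n a, r n a = H *ᵥ S n a + D *ᵥ η n a) (hX : X = F * X * Fᵀ + G * Q * Gᵀ) :
    ∀ᵐ a ∂P, HasMatMean (fun n => Matrix.vecMulVec (r n a) (r n a))
      (H * X * Hᵀ + D * Q * Dᵀ) := by
  have hm : ∀ i n, Measurable[ℱ n] (fun a => S n a i) := fun i n =>
    (measurable_pi_apply i).comp (measurable_state hη.measurable hS₀ hS n)
  filter_upwards [hη.ae_hasMean_mul,
    ae_all_iff.2 fun i => hη.ae_hasMean_predictable_mul (hm i)] with a h1 h2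
  have hb := IsWhiteNoise.bddPower_of_hasMean h1
  have hg : HasMatMean (fun n => Matrix.vecMulVec (η n a) (η n a)) Q := hasMatMean_iff.2 h1
  -- Convergence of the input's average power yields both its bounded power and its `o(√n)` growth.
  have hgG : ∀ i, HasMean (fun n => (G *ᵥ η n a) i ^ 2) ((G * Q * Gᵀ) i i) := fun i =>
    (hasMatMean_iff.1 ((hg.mul_left G).mul_right Gᵀ) i i).congr fun n => by
      rw [Matrix.mul_vecMulVec, Matrix.vecMulVec_mul, Matrix.vecMul_transpose,
        Matrix.vecMulVec_apply, pow_two]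
  have hsb : ∀ i, BddPower (fun n => S n a i) :=
    BddPower.of_stable (s := fun n => S n a) hF (fun n => hS n a) fun i => (hgG i).bddPower
  have hlim := tendsto_div_sqrt_of_stable (s := fun n => S n a) hF (fun n => hS n a) fun i => (hgG i).tendsto_div_sqrt
  have hsη : HasMatMean (fun n => Matrix.vecMulVec (S n a) (η n a)) 0 :=
    hasMatMean_iff.2 fun i j => h2 i (hsb i) j
  have hs := hasMatMean_state (s := fun n => S n a) hF (fun n => hS n a) hg hsη hlim hX
  simpa only [hr] using hasMatMean_output hg hsη hs H D

end StableOutput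

/-! ### Moments of the Gaussian noises. -/

section Gaussian

variable {Ω : Type*} [MeasurableSpace Ω] {P : Measure Ω} {d : ℕ}
  {g : ℕ → Ω → Fin d → ℝ} {S : Matrix (Fin d) (Fin d) ℝ}

theorem IsGaussianNoise.hasGaussianLaw_eval (hg : IsGaussianNoise P g S) (n : ℕ) (i : Fin d) :
    HasGaussianLaw (fun a => g n a i) P :=
  HasGaussianLaw.eval (X := fun i a => g n a i) (hg.gaussian n) i

theorem IsGaussianNoise.map_eval (hg : IsGaussianNoise P g S) (n : ℕ) (i : Fin d) :
    P.map (fun a => g n a i) = gaussianReal 0 (S i i).toNNReal := by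
  have h := hg.hasGaussianLaw_eval n i
  rw [h.map_eq_gaussianReal, variance_of_integral_eq_zero h.aemeasurable (hg.mean_zero n i),
    hg.mean_zero, ← hg.covariance n i i]
  simp only [pow_two]

theorem IsGaussianNoise.integral_pow_four (hg : IsGaussianNoise P g S) (n : ℕ) (i : Fin d) :
    ∫ a, g n a i ^ 4 ∂P = ∫ t, t ^ 4 ∂gaussianReal 0 (S i i).toNNReal := by
  rw [← hg.map_eval n i, integral_map (hg.hasGaussianLaw_eval n i).aemeasurable
    (by fun_prop)]

theorem IsGaussianNoise.memLp (hg : IsGaussianNoise P g S) (n : ℕ) (i : Fin d) :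
    MemLp (fun a => g n a i) 4 P :=
  (hg.hasGaussianLaw_eval n i).memLp (by norm_num)

end Gaussian

/-! ### The joint noise and its filtration. -/

/-- The index set of the coordinates of all noises at a given time. -/
abbrev NoiseIndex (p q m : ℕ) : Type := Fin p ⊕ Fin m ⊕ Fin q ⊕ Fin m ⊕ Fin p

/-- All noises at time `n`, collected in one vector. -/
def jointNoise {Ω : Type*} {p q m : ℕ} (w : ℕ → Ω → Fin p → ℝ) (z : ℕ → Ω → Fin m → ℝ)
    (e : ℕ → Ω → Fin q → ℝ) (ζ : ℕ → Ω → Fin m → ℝ) (ω : ℕ → Ω → Fin p → ℝ) (n : ℕ) (a : Ω) :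
    NoiseIndex p q m → ℝ :=
  Sum.elim (w n a) (Sum.elim (z n a) (Sum.elim (e n a) (Sum.elim (ζ n a) (ω n a))))

/-- The covariance matrix of the joint noise. -/
def jointCov {p q m : ℕ} (SW : Matrix (Fin p) (Fin p) ℝ) (SZ : Matrix (Fin m) (Fin m) ℝ)
    (SE : Matrix (Fin q) (Fin q) ℝ) (SS : Matrix (Fin m) (Fin m) ℝ)
    (SO : Matrix (Fin p) (Fin p) ℝ) : Matrix (NoiseIndex p q m) (NoiseIndex p q m) ℝ :=
  Matrix.fromBlocks SW 0 0 (Matrix.fromBlocks SZ 0 0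
    (Matrix.fromBlocks SE 0 0 (Matrix.fromBlocks SS 0 0 SO)))

/-- The first time at which the source of randomness belongs to the past. -/
def Source.time : Source → ℕ
  | .initial => 0
  | .process n => n + 1
  | .measurement n => n + 1
  | .excitation n => n + 1
  | .attackOutput n => n + 1
  | .attackState n => n + 1

/-- The source at time `n` of a coordinate of the joint noise. -/
def NoiseIndex.source {p q m : ℕ} (n : ℕ) : NoiseIndex p q m → Source
  | .inl _ => .process n
  | .inr (.inl _) => .measurement n
  | .inr (.inr (.inl _)) => .excitation n
  | .inr (.inr (.inr (.inl _))) => .attackOutput n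
  | .inr (.inr (.inr (.inr _))) => .attackState n

section JointNoise

variable {Ω : Type*} [mΩ : MeasurableSpace Ω] {P : Measure Ω} {p q m : ℕ}
  {x₀ xhat₀ ξ₀ : Ω → Fin p → ℝ} {w ω : ℕ → Ω → Fin p → ℝ} {z ζ : ℕ → Ω → Fin m → ℝ}
  {e : ℕ → Ω → Fin q → ℝ} {SW SO : Matrix (Fin p) (Fin p) ℝ} {SZ SS : Matrix (Fin m) (Fin m) ℝ}
  {SE : Matrix (Fin q) (Fin q) ℝ}

/-- The filtration generated by the sources of randomness. -/
def sourceFiltration (h : ∀ s, Source.sigmaAlgebra x₀ xhat₀ ξ₀ w z e ζ ω s ≤ mΩ) :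
    Filtration ℕ mΩ where
  seq n := ⨆ s ∈ {s : Source | s.time ≤ n}, Source.sigmaAlgebra x₀ xhat₀ ξ₀ w z e ζ ω s
  mono' _ _ hij := biSup_mono fun _ hs => le_trans hs hij
  le' _ := iSup₂_le fun s _ => h s

theorem sigmaAlgebra_le (hx₀ : Measurable x₀) (hxhat₀ : Measurable xhat₀) (hξ₀ : Measurable ξ₀)
    (hw : ∀ n, Measurable (w n)) (hz : ∀ n, Measurable (z n)) (he : ∀ n, Measurable (e n))
    (hζ : ∀ n, Measurable (ζ n)) (hω : ∀ n, Measurable (ω n)) (s : Source) :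
    Source.sigmaAlgebra x₀ xhat₀ ξ₀ w z e ζ ω s ≤ mΩ := by
  cases s with
  | initial => exact (hx₀.prodMk (hxhat₀.prodMk hξ₀)).comap_le
  | process n => exact (hw n).comap_le
  | measurement n => exact (hz n).comap_le
  | excitation n => exact (he n).comap_le
  | attackOutput n => exact (hζ n).comap_le
  | attackState n => exact (hω n).comap_le

omit mΩ in
theorem measurable_jointNoise_coord (n : ℕ) (i : NoiseIndex p q m) :
    Measurable[Source.sigmaAlgebra x₀ xhat₀ ξ₀ w z e ζ ω (NoiseIndex.source n i)]
      (fun a => jointNoise w z e ζ ω n a i) := by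
  rcases i with i | i | i | i | i
  · exact (measurable_pi_apply i).comp (comap_measurable (w n))
  · exact (measurable_pi_apply i).comp (comap_measurable (z n))
  · exact (measurable_pi_apply i).comp (comap_measurable (e n))
  · exact (measurable_pi_apply i).comp (comap_measurable (ζ n))
  · exact (measurable_pi_apply i).comp (comap_measurable (ω n))

theorem NoiseIndex.time_source (n : ℕ) (i : NoiseIndex p q m) :
    (NoiseIndex.source n i).time = n + 1 := by
  rcases i with i | i | i | i | i <;> rfl

/-- The noise at time `n` uses only sources of time `n + 1`, the past only sources of time at most
`n`. These are disjoint subfamilies of an independent family. -/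
theorem exists_isWhiteNoise (h : ∀ s, Source.sigmaAlgebra x₀ xhat₀ ξ₀ w z e ζ ω s ≤ mΩ)
    (hw : IsGaussianNoise P w SW) (hz : IsGaussianNoise P z SZ) (he : IsGaussianNoise P e SE)
    (hζ : IsGaussianNoise P ζ SS) (hω : IsGaussianNoise P ω SO)
    (hindep : SourcesIndependent P x₀ xhat₀ ξ₀ w z e ζ ω) :
    ∃ c, IsWhiteNoise P (sourceFiltration h) (jointNoise w z e ζ ω)
      (jointCov SW SZ SE SS SO) c := by
  have hmeas : ∀ n (T : Set Source), (∀ i : NoiseIndex p q m, NoiseIndex.source n i ∈ T) →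
      Measurable[⨆ s ∈ T, Source.sigmaAlgebra x₀ xhat₀ ξ₀ w z e ζ ω s]
        (jointNoise w z e ζ ω n) := fun n T hT => by
    refine (@measurable_pi_iff _ _ _ (_) _ _).2 fun i => ?_
    exact (measurable_jointNoise_coord n i).mono (le_iSup₂_of_le _ (hT i) le_rfl) le_rfl
  have hcoord : ∀ n i, Measurable (fun a => jointNoise w z e ζ ω n a i) := fun n i =>
    (measurable_jointNoise_coord n i).mono (h _) le_rfl
  have hmean : ∀ n i, ∫ a, jointNoise w z e ζ ω n a i ∂P = 0 := by
    intro n i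
    rcases i with i | i | i | i | i
    exacts [hw.mean_zero n i, hz.mean_zero n i, he.mean_zero n i, hζ.mean_zero n i,
      hω.mean_zero n i]
  have hoff : ∀ n i j, NoiseIndex.source n i ≠ NoiseIndex.source n j →
      ∫ a, jointNoise w z e ζ ω n a i * jointNoise w z e ζ ω n a j ∂P = 0 := by
    intro n i j hij
    have hI : IndepFun (fun a => jointNoise w z e ζ ω n a i)
        (fun a => jointNoise w z e ζ ω n a j) P := by
      rw [IndepFun_iff_Indep]
      exact indep_of_indep_of_le_left (indep_of_indep_of_le_right (hindep.indep hij)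
        (measurable_jointNoise_coord n j).comap_le) (measurable_jointNoise_coord n i).comap_le
    rw [hI.integral_fun_mul_eq_mul_integral (hcoord n i).aestronglyMeasurable
      (hcoord n j).aestronglyMeasurable, hmean, zero_mul]
  -- A centered Gaussian's fourth moment depends only on its variance, so summing over coordinates
  -- gives a bound uniform in `n`.
  refine ⟨∑ i, ∫ t, t ^ 4 ∂gaussianReal 0 (jointCov SW SZ SE SS SO i i).toNNReal,
    fun n => hmeas n _ fun i => (NoiseIndex.time_source n i).le, fun n => ?_, ?_, hmean, ?_,
    fun n i => ?_⟩
  · refine indep_of_indep_of_le_left (indep_iSup_of_disjoint h hindep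
      (S := {s | s.time = n + 1}) (T := {s | s.time ≤ n}) ?_) (hmeas n _ fun i =>
        NoiseIndex.time_source n i).comap_le
    refine Set.disjoint_left.2 fun s hs hs' => ?_
    exact absurd (hs.symm.trans_le hs') (by omega)
  · intro n i
    rcases i with i | i | i | i | i
    exacts [hw.memLp n i, hz.memLp n i, he.memLp n i, hζ.memLp n i, hω.memLp n i]
  · intro n i j
    rcases i with i | i | i | i | i <;> rcases j with j | j | j | j | j <;>
    first
    | exact hoff n _ _ (by simp [NoiseIndex.source])
    | exact hw.covariance n i j
    | exact hz.covariance n i j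
    | exact he.covariance n i j
    | exact hζ.covariance n i j
    | exact hω.covariance n i j
  · have h4 : ∫ a, jointNoise w z e ζ ω n a i ^ 4 ∂P =
        ∫ t, t ^ 4 ∂gaussianReal 0 (jointCov SW SZ SE SS SO i i).toNNReal := by
      rcases i with i | i | i | i | i
      exacts [hw.integral_pow_four n i, hz.integral_pow_four n i, he.integral_pow_four n i,
        hζ.integral_pow_four n i, hω.integral_pow_four n i]
    rw [h4]
    exact Finset.single_le_sum
      (f := fun i => ∫ t, t ^ 4 ∂gaussianReal 0 (jointCov SW SZ SE SS SO i i).toNNReal)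
      (fun i _ => integral_nonneg fun t => (by decide : Even 4).pow_nonneg t)
      (Finset.mem_univ i)

theorem measurable_initial (h : ∀ s, Source.sigmaAlgebra x₀ xhat₀ ξ₀ w z e ζ ω s ≤ mΩ) :
    Measurable[sourceFiltration h 0] (fun a => (x₀ a, xhat₀ a, ξ₀ a)) :=
  (comap_measurable (fun a => (x₀ a, xhat₀ a, ξ₀ a))).mono
    (le_iSup₂_of_le (f := fun s (_ : s ∈ {s : Source | s.time ≤ 0}) =>
      Source.sigmaAlgebra x₀ xhat₀ ξ₀ w z e ζ ω s) Source.initial (le_refl 0) le_rfl) le_rfl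

end JointNoise

/-! ### Rank, positivity and zero output covariance. -/

section LinearAlgebra

variable {ι κ ρ : Type*} [Fintype ι] [Fintype κ]

theorem Matrix.eq_zero_of_mul_eq_zero_of_rank_eq {q : ℕ} {M : Matrix ρ (Fin q) ℝ}
    {S : Matrix (Fin q) (Fin q) ℝ} (hS : S.rank = q) (h : M * S = 0) : M = 0 := by
  have h1 : LinearMap.range S.mulVecLin = ⊤ :=
    Submodule.eq_top_of_finrank_eq (by rw [Module.finrank_fin_fun]; exact hS)
  ext i j
  obtain ⟨v, hv⟩ : Pi.single j 1 ∈ LinearMap.range S.mulVecLin := h1 ▸ Submodule.mem_top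
  have h2 : M *ᵥ (S *ᵥ v) = 0 := by rw [Matrix.mulVec_mulVec, h, Matrix.zero_mulVec]
  rw [Matrix.mulVecLin_apply] at hv
  rw [hv, Matrix.mulVec_single_one] at h2
  exact congrFun h2 i

theorem Matrix.PosSemidef.fromBlocks_diagonal {A : Matrix ι ι ℝ} {B : Matrix κ κ ℝ}
    (hA : A.PosSemidef) (hB : B.PosSemidef) : (Matrix.fromBlocks A 0 0 B).PosSemidef := by
  refine .of_dotProduct_mulVec_nonneg
    (Matrix.IsHermitian.fromBlocks hA.isHermitian (by simp) hB.isHermitian) fun x => ?_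
  have hA' := hA.dotProduct_mulVec_nonneg (x ∘ Sum.inl)
  have hB' := hB.dotProduct_mulVec_nonneg (x ∘ Sum.inr)
  rw [star_trivial] at *
  rw [Matrix.fromBlocks_mulVec]
  simpa [dotProduct, Fintype.sum_sum_type] using add_nonneg hA' hB'

/-- If the output of a stable system has zero covariance, then its impulse response vanishes on the
range of the input covariance. -/
theorem eq_zero_of_stein_output [Fintype ρ] [DecidableEq ι] {F X Y : Matrix ι ι ℝ}
    {H : Matrix ρ ι ℝ} {R : Matrix ρ ρ ℝ} (hF : Tendsto (fun n : ℕ => F ^ n) atTop (𝓝 0))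
    (hX : X = F * X * Fᵀ + Y) (hY : Y.PosSemidef) (hR : R.PosSemidef)
    (h : H * X * Hᵀ + R = 0) : R = 0 ∧ ∀ k : ℕ, H * F ^ k * Y = 0 := by
  classical
  -- Each term of the series for `H X Hᵀ` is the form of `Y` at `(H F ^ k)ᵀ y`, hence nonnegative.
  -- As the total with `R` is zero, every term vanishes, and a semidefinite form vanishes only on
  -- its kernel.
  have hquad : ∀ (y : ρ → ℝ) (k : ℕ), y ⬝ᵥ (H * (F ^ k * Y * (F ^ k)ᵀ) * Hᵀ) *ᵥ y =
      star ((H * F ^ k)ᵀ *ᵥ y) ⬝ᵥ Y *ᵥ ((H * F ^ k)ᵀ *ᵥ y) := fun y k => by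
    rw [star_trivial, Matrix.mulVec_transpose, ← Matrix.mulVec_transpose, Matrix.mulVec_mulVec,
      Matrix.mulVec_transpose, ← Matrix.dotProduct_mulVec, Matrix.mulVec_mulVec]
    simp only [Matrix.transpose_mul, Matrix.mul_assoc]
  have hterm : ∀ (y : ρ → ℝ) (k : ℕ), 0 ≤ y ⬝ᵥ (H * (F ^ k * Y * (F ^ k)ᵀ) * Hᵀ) *ᵥ y :=
    fun y k => by rw [hquad]; exact hY.dotProduct_mulVec_nonneg _
  have hlim : ∀ y : ρ → ℝ, Tendsto (fun n => ∑ k ∈ Finset.range n,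
      y ⬝ᵥ (H * (F ^ k * Y * (F ^ k)ᵀ) * Hᵀ) *ᵥ y) atTop (𝓝 (y ⬝ᵥ (H * X * Hᵀ) *ᵥ y)) := by
    intro y
    have hc : Continuous fun Z : Matrix ι ι ℝ => y ⬝ᵥ (H * Z * Hᵀ) *ᵥ y := by fun_prop
    refine ((hc.tendsto X).comp (tendsto_sum_of_stein hF hX)).congr fun n => ?_
    simp only [Function.comp_apply, Matrix.mul_sum, Matrix.sum_mul, Matrix.sum_mulVec,
      dotProduct_sum]
  have hle : ∀ (y : ρ → ℝ) (k : ℕ), y ⬝ᵥ (H * (F ^ k * Y * (F ^ k)ᵀ) * Hᵀ) *ᵥ y ≤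
      y ⬝ᵥ (H * X * Hᵀ) *ᵥ y := by
    intro y k
    refine ge_of_tendsto (hlim y) ?_
    filter_upwards [eventually_gt_atTop k] with n hn
    exact Finset.single_le_sum (f := fun k => y ⬝ᵥ (H * (F ^ k * Y * (F ^ k)ᵀ) * Hᵀ) *ᵥ y)
      (fun k _ => hterm y k) (Finset.mem_range.2 hn)
  have hsum : ∀ y : ρ → ℝ, y ⬝ᵥ (H * X * Hᵀ) *ᵥ y + y ⬝ᵥ R *ᵥ y = 0 := fun y => by
    rw [← dotProduct_add, ← Matrix.add_mulVec, h, Matrix.zero_mulVec, dotProduct_zero]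
  have hRy : ∀ y : ρ → ℝ, 0 ≤ y ⬝ᵥ R *ᵥ y := fun y => by
    simpa using hR.dotProduct_mulVec_nonneg y
  constructor
  · refine Matrix.ext_of_mulVec_single fun i => ?_
    rw [Matrix.zero_mulVec]
    refine (hR.dotProduct_mulVec_zero_iff _).1 ?_
    rw [star_trivial]
    generalize (Pi.single i 1 : ρ → ℝ) = y
    linarith [hsum y, hRy y, hle y 0, hterm y 0]
  · intro k
    have h1 : Y * (H * F ^ k)ᵀ = 0 := by
      refine Matrix.ext_of_mulVec_single fun i => ?_
      generalize (Pi.single i 1 : ρ → ℝ) = y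
      rw [Matrix.zero_mulVec, ← Matrix.mulVec_mulVec]
      refine (hY.dotProduct_mulVec_zero_iff _).1 ?_
      rw [← hquad]
      linarith [hsum y, hRy y, hle y k, hterm y k]
    have h2 := congrArg Matrix.transpose h1
    have h3 : Yᵀ = Y := by simpa using hY.isHermitian.eq
    rwa [Matrix.transpose_mul, Matrix.transpose_transpose, h3, Matrix.transpose_zero] at h2

end LinearAlgebra

theorem IsGaussianNoise.posSemidef {Ω : Type*} [MeasurableSpace Ω] {P : Measure Ω} {d : ℕ}
    {g : ℕ → Ω → Fin d → ℝ} {S : Matrix (Fin d) (Fin d) ℝ} [IsProbabilityMeasure P]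
    (hg : IsGaussianNoise P g S) : S.PosSemidef := by
  refine .of_dotProduct_mulVec_nonneg ?_ fun x => ?_
  · ext i j
    rw [Matrix.conjTranspose_apply, star_trivial, ← hg.covariance 0, ← hg.covariance 0]
    simp only [mul_comm]
  · have hI : ∀ i j, Integrable (fun a => x i * x j * (g 0 a i * g 0 a j)) P := fun i j =>
      (((hg.memLp 0 i).mono_exponent (by norm_num)).integrable_mul
        ((hg.memLp 0 j).mono_exponent (by norm_num)) (p := 2) (q := 2)).const_mul _
    have h1 : ∫ a, (∑ i, x i * g 0 a i) ^ 2 ∂P = star x ⬝ᵥ S *ᵥ x := by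
      simp only [pow_two, Finset.sum_mul_sum, mul_mul_mul_comm]
      rw [integral_finsetSum _ fun i _ => integrable_finsetSum _ fun j _ => hI i j]
      simp only [dotProduct, Matrix.mulVec, star_trivial, Finset.mul_sum]
      refine Finset.sum_congr rfl fun i _ => ?_
      rw [integral_finsetSum _ fun j _ => hI i j]
      refine Finset.sum_congr rfl fun j _ => ?_
      rw [integral_const_mul, hg.covariance]
      ring
    rw [← h1]
    exact integral_nonneg fun a => sq_nonneg _

/-! ### State-space form of the attacked loop. -/

section Loop

variable {p q m : ℕ}

/-- The state matrix of the attacked loop, acting on the plant state, the observer error and the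
false state. -/
def loopMatrix (A : Matrix (Fin p) (Fin p) ℝ) (B : Matrix (Fin p) (Fin q) ℝ)
    (C : Matrix (Fin m) (Fin p) ℝ) (K : Matrix (Fin q) (Fin p) ℝ) (L : Matrix (Fin p) (Fin m) ℝ)
    (α : ℝ) : Matrix (Fin p ⊕ Fin p ⊕ Fin p) (Fin p ⊕ Fin p ⊕ Fin p) ℝ :=
  .fromRows (.fromCols (A + B * K) (.fromCols (B * K) 0))
    (.fromRows (.fromCols (-(α • (L * C))) (.fromCols (A + L * C) (-(L * C))))
      (.fromCols 0 (.fromCols 0 (A + B * K))))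

/-- The input matrix of the attacked loop. -/
def loopInput (B : Matrix (Fin p) (Fin q) ℝ) (L : Matrix (Fin p) (Fin m) ℝ) (α : ℝ) :
    Matrix (Fin p ⊕ Fin p ⊕ Fin p) (NoiseIndex p q m) ℝ :=
  .fromRows (.fromCols 1 (.fromCols 0 (.fromCols B (.fromCols 0 0))))
    (.fromRows (.fromCols (-1) (.fromCols (-((1 + α) • L)) (.fromCols 0 (.fromCols (-L) 0))))
      (.fromCols 0 (.fromCols 0 (.fromCols 0 (.fromCols 0 1)))))

/-- The matrix giving the innovation from the state of the attacked loop. -/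
def loopOutput (C : Matrix (Fin m) (Fin p) ℝ) (α : ℝ) : Matrix (Fin m) (Fin p ⊕ Fin p ⊕ Fin p) ℝ :=
  .fromCols (-(α • C)) (.fromCols C (-C))

/-- The direct feedthrough from the noise to the innovation. -/
def loopFeedthrough (p q m : ℕ) (α : ℝ) : Matrix (Fin m) (NoiseIndex p q m) ℝ :=
  .fromCols 0 (.fromCols (-((1 + α) • 1)) (.fromCols 0 (.fromCols (-1) 0)))

/-- The state matrix of the observer error and the false state, when `α = 0`. -/
def errorMatrix (A : Matrix (Fin p) (Fin p) ℝ) (B : Matrix (Fin p) (Fin q) ℝ)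
    (C : Matrix (Fin m) (Fin p) ℝ) (K : Matrix (Fin q) (Fin p) ℝ) (L : Matrix (Fin p) (Fin m) ℝ) :
    Matrix (Fin p ⊕ Fin p) (Fin p ⊕ Fin p) ℝ :=
  .fromBlocks (A + L * C) (-(L * C)) 0 (A + B * K)

/-- The input matrix of the observer error and the false state, when `α = 0`. -/
def errorInput (q : ℕ) (L : Matrix (Fin p) (Fin m) ℝ) :
    Matrix (Fin p ⊕ Fin p) (NoiseIndex p q m) ℝ :=
  .fromRows (.fromCols (-1) (.fromCols (-L) (.fromCols 0 (.fromCols (-L) 0))))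
    (.fromCols 0 (.fromCols 0 (.fromCols 0 (.fromCols 0 1))))

variable {Ω : Type*} {A : Matrix (Fin p) (Fin p) ℝ} {B : Matrix (Fin p) (Fin q) ℝ}
  {C : Matrix (Fin m) (Fin p) ℝ} {K : Matrix (Fin q) (Fin p) ℝ} {L : Matrix (Fin p) (Fin m) ℝ}
  {α : ℝ} {x xhat ξ w ω : ℕ → Ω → Fin p → ℝ} {u e : ℕ → Ω → Fin q → ℝ}
  {y z v ζ : ℕ → Ω → Fin m → ℝ}

theorem innovation_eq (hloop : IsClosedLoop A B C K L x xhat u y v w z e)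
    (hattack : IsAttack A B C K α x ξ z v ζ ω) (n : ℕ) (a : Ω) :
    innovation C xhat y n a = C *ᵥ (xhat n a - x n a) - α • (C *ᵥ x n a) - (1 + α) • z n a -
      C *ᵥ ξ n a - ζ n a := by
  rw [innovation, hloop.output, hattack.attack, Matrix.mulVec_sub]
  module

theorem state_succ (hloop : IsClosedLoop A B C K L x xhat u y v w z e) (n : ℕ) (a : Ω) :
    x (n + 1) a = (A + B * K) *ᵥ x n a + (B * K) *ᵥ (xhat n a - x n a) + B *ᵥ e n a + w n a := by
  rw [hloop.state, hloop.input]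
  simp only [Matrix.add_mulVec, Matrix.mulVec_sub, Matrix.mulVec_add, ← Matrix.mulVec_mulVec]
  abel

theorem error_succ (hloop : IsClosedLoop A B C K L x xhat u y v w z e)
    (hattack : IsAttack A B C K α x ξ z v ζ ω) (n : ℕ) (a : Ω) :
    xhat (n + 1) a - x (n + 1) a = (A + L * C) *ᵥ (xhat n a - x n a) - α • (L * C) *ᵥ x n a -
      (L * C) *ᵥ ξ n a - w n a - (1 + α) • L *ᵥ z n a - L *ᵥ ζ n a := by
  have h := innovation_eq hloop hattack n a
  rw [innovation] at h
  rw [hloop.state, hloop.observer, h]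
  simp only [Matrix.add_mulVec, Matrix.mulVec_sub, Matrix.mulVec_smul, ← Matrix.mulVec_mulVec]
  module

/-- The state of the attacked loop. -/
def loopState (x xhat ξ : ℕ → Ω → Fin p → ℝ) (n : ℕ) (a : Ω) : Fin p ⊕ Fin p ⊕ Fin p → ℝ :=
  Sum.elim (x n a) (Sum.elim (xhat n a - x n a) (ξ n a))

theorem loopState_succ (hloop : IsClosedLoop A B C K L x xhat u y v w z e)
    (hattack : IsAttack A B C K α x ξ z v ζ ω) (n : ℕ) (a : Ω) :
    loopState x xhat ξ (n + 1) a = loopMatrix A B C K L α *ᵥ loopState x xhat ξ n a +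
      loopInput B L α *ᵥ jointNoise w z e ζ ω n a := by
  rw [loopState, error_succ hloop hattack, state_succ hloop, hattack.falseState]
  simp only [loopState, loopMatrix, loopInput, jointNoise, Matrix.fromRows_mulVec,
    Matrix.fromCols_mulVec_sumElim, Matrix.zero_mulVec, Matrix.one_mulVec, Matrix.neg_mulVec,
    Matrix.smul_mulVec, ← Sum.elim_add_add]
  congr 1
  · module
  · congr 1
    · module
    · module

theorem innovation_eq_output (hloop : IsClosedLoop A B C K L x xhat u y v w z e)
    (hattack : IsAttack A B C K α x ξ z v ζ ω) (n : ℕ) (a : Ω) :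
    innovation C xhat y n a = loopOutput C α *ᵥ loopState x xhat ξ n a +
      loopFeedthrough p q m α *ᵥ jointNoise w z e ζ ω n a := by
  rw [innovation_eq hloop hattack]
  simp only [loopState, loopOutput, loopFeedthrough, jointNoise,
    Matrix.fromCols_mulVec_sumElim, Matrix.zero_mulVec, Matrix.one_mulVec, Matrix.neg_mulVec,
    Matrix.smul_mulVec]
  module

/-- The observer error and the false state. -/
def errorState (x xhat ξ : ℕ → Ω → Fin p → ℝ) (n : ℕ) (a : Ω) : Fin p ⊕ Fin p → ℝ :=
  Sum.elim (xhat n a - x n a) (ξ n a)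

theorem errorState_succ (hloop : IsClosedLoop A B C K L x xhat u y v w z e)
    (hattack : IsAttack A B C K 0 x ξ z v ζ ω) (n : ℕ) (a : Ω) :
    errorState x xhat ξ (n + 1) a = errorMatrix A B C K L *ᵥ errorState x xhat ξ n a +
      errorInput q L *ᵥ jointNoise w z e ζ ω n a := by
  rw [errorState, error_succ hloop hattack, hattack.falseState]
  simp only [errorState, errorMatrix, ← Matrix.fromRows_fromCols_eq_fromBlocks, errorInput,
    jointNoise, Matrix.fromRows_mulVec, Matrix.fromCols_mulVec_sumElim, Matrix.zero_mulVec,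
    Matrix.one_mulVec, Matrix.neg_mulVec, ← Sum.elim_add_add]
  congr 1
  · module
  · module

theorem innovation_eq_error_output (hloop : IsClosedLoop A B C K L x xhat u y v w z e)
    (hattack : IsAttack A B C K 0 x ξ z v ζ ω) (n : ℕ) (a : Ω) :
    innovation C xhat y n a = Matrix.fromCols C (-C) *ᵥ errorState x xhat ξ n a +
      loopFeedthrough p q m 0 *ᵥ jointNoise w z e ζ ω n a := by
  rw [innovation_eq hloop hattack]
  simp only [errorState, loopFeedthrough, jointNoise,
    Matrix.fromCols_mulVec_sumElim, Matrix.zero_mulVec, Matrix.one_mulVec, Matrix.neg_mulVec,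
    Matrix.smul_mulVec]
  module

variable {SW SO : Matrix (Fin p) (Fin p) ℝ} {SZ SS : Matrix (Fin m) (Fin m) ℝ}
  {SE : Matrix (Fin q) (Fin q) ℝ}

/-- The noises `w`, `z`, `ζ` enter only the observer error and `ω` only the false state, so the
cross blocks vanish. -/
theorem errorInput_mul_jointCov :
    errorInput q L * jointCov SW SZ SE SS SO * (errorInput q L)ᵀ =
      Matrix.fromBlocks (SW + L * SZ * Lᵀ + L * SS * Lᵀ) 0 0 SO := by
  simp only [errorInput, jointCov, Matrix.fromRows_mul, Matrix.fromCols_mul_fromBlocks,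
    Matrix.transpose_fromRows, Matrix.transpose_fromCols, Matrix.mul_fromCols,
    Matrix.fromCols_mul_fromRows]
  simp [← Matrix.fromRows_fromCols_eq_fromBlocks, Matrix.fromCols_mul_fromRows, add_assoc]

theorem loopFeedthrough_mul_jointCov :
    loopFeedthrough p q m 0 * jointCov SW SZ SE SS SO * (loopFeedthrough p q m 0)ᵀ = SZ + SS := by
  simp only [loopFeedthrough, jointCov, Matrix.fromCols_mul_fromBlocks,
    Matrix.transpose_fromCols, Matrix.fromCols_mul_fromRows]
  simp [Matrix.fromCols_mul_fromRows]

/-- The response of the innovation to the excitation, at the first lag where it does not vanish. -/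
theorem loop_impulse_response {k' : ℕ}
    (hk' : ∀ k < k', C * (A + B * K) ^ k * B = 0) (i : Fin m) (j : Fin q) :
    (loopOutput C α * loopMatrix A B C K L α ^ k' * loopInput B L α * jointCov SW SZ SE SS SO) i
      (.inr (.inr (.inl j))) = -(α • (C * (A + B * K) ^ k' * B * SE)) i j := by
  have hQ : (fun l => jointCov SW SZ SE SS SO l (.inr (.inr (.inl j)))) =
      Sum.elim (0 : Fin p → ℝ) (Sum.elim (0 : Fin m → ℝ) (Sum.elim (SE.col j)
        (Sum.elim (0 : Fin m → ℝ) (0 : Fin p → ℝ)))) := by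
    funext l
    rcases l with l | l | l | l | l <;> rfl
  have hG : loopInput B L α *ᵥ Sum.elim (0 : Fin p → ℝ) (Sum.elim (0 : Fin m → ℝ) (Sum.elim (SE.col j)
        (Sum.elim (0 : Fin m → ℝ) (0 : Fin p → ℝ)))) =
      Sum.elim (B *ᵥ SE.col j) (Sum.elim (0 : Fin p → ℝ) (0 : Fin p → ℝ)) := by
    simp only [loopInput, Matrix.fromRows_mulVec, Matrix.fromCols_mulVec_sumElim,
      Matrix.mulVec_zero, Matrix.zero_mulVec, add_zero, zero_add]
  -- The plant state leaks into the observer error only through `-α L C`. Before lag `k'` the factor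
  -- `C` annihilates the response, so the error coordinate stays zero.
  have hF : ∀ k ≤ k', loopMatrix A B C K L α ^ k *ᵥ Sum.elim (B *ᵥ SE.col j) (Sum.elim (0 : Fin p → ℝ) (0 : Fin p → ℝ)) =
      Sum.elim ((A + B * K) ^ k *ᵥ B *ᵥ SE.col j) (Sum.elim 0 0) := by
    intro k hk
    induction k with
    | zero => simp
    | succ k ih =>
      have h0 : C *ᵥ (A + B * K) ^ k *ᵥ B *ᵥ SE.col j = 0 := by
        rw [Matrix.mulVec_mulVec, Matrix.mulVec_mulVec, hk' k hk,
          Matrix.zero_mulVec]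
      rw [pow_succ', ← Matrix.mulVec_mulVec, ih (by omega), pow_succ' (A + B * K),
        ← Matrix.mulVec_mulVec (B *ᵥ SE.col j)]
      simp only [loopMatrix, Matrix.fromRows_mulVec, Matrix.fromCols_mulVec_sumElim,
        Matrix.neg_mulVec, Matrix.smul_mulVec, ← Matrix.mulVec_mulVec _ L C, h0]
      simp
  have e : (loopOutput C α * loopMatrix A B C K L α ^ k' * loopInput B L α *
      jointCov SW SZ SE SS SO) i (.inr (.inr (.inl j))) =
      (loopOutput C α *ᵥ loopMatrix A B C K L α ^ k' *ᵥ loopInput B L α *ᵥ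
        fun l => jointCov SW SZ SE SS SO l (.inr (.inr (.inl j)))) i := by
    simp only [Matrix.mulVec_mulVec, ← Matrix.mul_assoc]
    rfl
  rw [e, hQ, hG, hF k' le_rfl]
  simp only [loopOutput, Matrix.fromCols_mulVec_sumElim, Matrix.mulVec_zero, add_zero,
    Matrix.mulVec_mulVec]
  simp only [← Matrix.mul_assoc, Matrix.neg_mul, Matrix.smul_mul, Matrix.neg_mulVec,
    Matrix.smul_mulVec]
  rfl

end Loop

/-! ### Consequences of the two tests. -/

section Tests

theorem hasZeroAveragePower_of_hasMatMean {Ω : Type*} {mΩ : MeasurableSpace Ω} {P : Measure Ω}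
    {m : ℕ} {v : ℕ → Ω → Fin m → ℝ}
    (h : ∀ᵐ a ∂P, HasMatMean (fun n => Matrix.vecMulVec (v n a) (v n a)) 0) :
    HasZeroAveragePower P v := by
  filter_upwards [h] with a ha
  have := HasMean.sum Finset.univ fun i _ => hasMatMean_iff.1 ha i i
  simpa [HasMean, Matrix.vecMulVec_apply, dotProduct] using this

variable {Ω : Type*} {mΩ : MeasurableSpace Ω} {P : Measure Ω} [IsProbabilityMeasure P]
  {ℱ : Filtration ℕ mΩ} {p q m : ℕ} {c : ℝ}
  {A : Matrix (Fin p) (Fin p) ℝ} {B : Matrix (Fin p) (Fin q) ℝ}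
  {C : Matrix (Fin m) (Fin p) ℝ} {K : Matrix (Fin q) (Fin p) ℝ} {L : Matrix (Fin p) (Fin m) ℝ}
  {α : ℝ} {x xhat ξ w ω : ℕ → Ω → Fin p → ℝ} {u e : ℕ → Ω → Fin q → ℝ}
  {y z v ζ : ℕ → Ω → Fin m → ℝ} {SW SO SΔ : Matrix (Fin p) (Fin p) ℝ}
  {SZ SS : Matrix (Fin m) (Fin m) ℝ} {SE : Matrix (Fin q) (Fin q) ℝ}

theorem measurable_sumElim {κ τ : Type*} {mΩ : MeasurableSpace Ω} {f : Ω → κ → ℝ} {g : Ω → τ → ℝ}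
    (hf : Measurable f) (hg : Measurable g) : Measurable fun a => Sum.elim (f a) (g a) := by
  refine measurable_pi_iff.2 fun i => ?_
  rcases i with i | i
  · exact (measurable_pi_apply i).comp hf
  · exact (measurable_pi_apply i).comp hg

/-- The two tests rule out any scaling of the measurements. -/
theorem scaling_eq_zero_of_tests {k' : ℕ}
    (hη : IsWhiteNoise P ℱ (jointNoise w z e ζ ω) (jointCov SW SZ SE SS SO) c)
    (hS₀ : Measurable[ℱ 0] (loopState x xhat ξ 0))
    (hloop : IsClosedLoop A B C K L x xhat u y v w z e)
    (hattack : IsAttack A B C K α x ξ z v ζ ω) (hSE : SE.rank = q)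
    (hk' : IsLeast {k : ℕ | C * (A + B * K) ^ k * B ≠ 0} k')
    (htest1 : CovarianceTest P C SZ SΔ xhat y) (htest2 : CorrelationTest P C k' xhat y e) :
    α = 0 := by
  have h0 : ∀ k < k', C * (A + B * K) ^ k * B = 0 := fun k hk => by
    by_contra hne
    exact absurd (hk'.2 hne) (by omega)
  -- The claim is deterministic, so one good sample path suffices.
  obtain ⟨a, h1, h2, h3⟩ := (htest1.and (htest2.and (ae_hasMean_output_mul_noise hη hS₀
    (loopState_succ hloop hattack) (innovation_eq_output hloop hattack) k'))).exists
  have hbdd : ∀ i, BddPower (fun n => innovation C xhat y n a i) := fun i =>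
    ((hasMatMean_iff.1 h1 i i).congr fun n => (pow_two _).symm).bddPower
  have hzero : α • (C * (A + B * K) ^ k' * B * SE) = 0 := by
    ext i j
    have h4 := h3 hbdd i (.inr (.inr (.inl j)))
    rw [loop_impulse_response h0] at h4
    -- The shift discards the initial terms where the delayed excitation is zero by default.
    have h5 := ((hasMatMean_iff.1 h2 i j).shift (k' + 1)).congr
      (b := fun n => innovation C xhat y (n + k' + 1) a i *
        jointNoise w z e ζ ω n a (.inr (.inr (.inl j)))) fun n => by
      simp [Matrix.vecMulVec_apply, delayed, jointNoise, add_assoc]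
    exact neg_eq_zero.1 (h4.unique h5)
  rcases smul_eq_zero.1 hzero with h | h
  · exact h
  · exact absurd (Matrix.eq_zero_of_mul_eq_zero_of_rank_eq hSE h) hk'.1

/-- Without scaling, the covariance test forces the attack noises to be invisible. -/
theorem attack_covariance_eq_zero
    (hη : IsWhiteNoise P ℱ (jointNoise w z e ζ ω) (jointCov SW SZ SE SS SO) c)
    (hS₀ : Measurable[ℱ 0] (errorState x xhat ξ 0))
    (hK : IsSchurStable (A + B * K)) (hL : IsSchurStable (A + L * C))
    (hSS : SS.PosSemidef) (hSO : SO.PosSemidef)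
    (hloop : IsClosedLoop A B C K L x xhat u y v w z e)
    (hattack : IsAttack A B C K 0 x ξ z v ζ ω) (hSΔ : IsErrorCovariance A C L SW SZ SΔ)
    (htest1 : CovarianceTest P C SZ SΔ xhat y) :
    SS = 0 ∧ ∀ k : ℕ, C * (A + B * K) ^ k * SO = 0 := by
  have hF : Tendsto (fun n : ℕ => errorMatrix A B C K L ^ n) atTop (𝓝 0) :=
    tendsto_pow_of_spectrum_lt_one _ (spectrum_lt_one_fromBlocks _ hL hK)
  -- `X` is the share of the stationary covariance due to the attack noises. By linearity it adds to
  -- the share `SΔ` of the unattacked observer.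
  obtain ⟨X, hX⟩ := exists_stein hF (Matrix.fromBlocks (L * SS * Lᵀ) 0 0 SO)
  have hX' : Matrix.fromBlocks SΔ 0 0 0 + X =
      errorMatrix A B C K L * (Matrix.fromBlocks SΔ 0 0 0 + X) * (errorMatrix A B C K L)ᵀ +
        errorInput q L * jointCov SW SZ SE SS SO * (errorInput q L)ᵀ := by
    have e1 : errorMatrix A B C K L * Matrix.fromBlocks SΔ 0 0 0 * (errorMatrix A B C K L)ᵀ =
        Matrix.fromBlocks ((A + L * C) * SΔ * (A + L * C)ᵀ) 0 0 0 := by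
      simp [errorMatrix, Matrix.fromBlocks_multiply, Matrix.fromBlocks_transpose]
    have e2 : Matrix.fromBlocks (SW + L * SZ * Lᵀ + L * SS * Lᵀ) 0 0 SO =
        Matrix.fromBlocks (SW + L * SZ * Lᵀ) 0 0 (0 : Matrix (Fin p) (Fin p) ℝ) +
          Matrix.fromBlocks (L * SS * Lᵀ) 0 0 SO := by
      simp [Matrix.fromBlocks_add]
    have e3 : Matrix.fromBlocks SΔ 0 0 (0 : Matrix (Fin p) (Fin p) ℝ) =
        Matrix.fromBlocks ((A + L * C) * SΔ * (A + L * C)ᵀ) 0 0 0 +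
          Matrix.fromBlocks (SW + L * SZ * Lᵀ) 0 0 (0 : Matrix (Fin p) (Fin p) ℝ) := by
      rw [Matrix.fromBlocks_add, ← add_assoc, ← hSΔ.2]
      simp
    rw [errorInput_mul_jointCov, e2, Matrix.mul_add, Matrix.add_mul, e1, add_add_add_comm, ← hX,
      ← e3]
  obtain ⟨a, h1, h2⟩ := (htest1.and (ae_hasMatMean_output hη hS₀ hF
    (errorState_succ hloop hattack) (innovation_eq_error_output hloop hattack) hX')).exists
  have h3 := HasMatMean.unique h2 h1
  have e4 : Matrix.fromCols C (-C) * Matrix.fromBlocks SΔ 0 0 (0 : Matrix (Fin p) (Fin p) ℝ) *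
      (Matrix.fromCols C (-C))ᵀ =
      C * SΔ * Cᵀ := by
    simp [Matrix.fromCols_mul_fromBlocks, Matrix.transpose_fromCols, Matrix.fromCols_mul_fromRows]
  have h4 : Matrix.fromCols C (-C) * X * (Matrix.fromCols C (-C))ᵀ + SS = 0 := by
    rw [loopFeedthrough_mul_jointCov, Matrix.mul_add, Matrix.add_mul, e4] at h3
    have h5 : C * SΔ * Cᵀ + Matrix.fromCols C (-C) * X * (Matrix.fromCols C (-C))ᵀ + (SZ + SS) =
      C * SΔ * Cᵀ + SZ + (Matrix.fromCols C (-C) * X * (Matrix.fromCols C (-C))ᵀ + SS) := by abel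
    rw [h5] at h3
    exact add_eq_left.1 h3
  have hLS : (L * SS * Lᵀ).PosSemidef := hSS.mul_mul_conjTranspose_same L
  obtain ⟨hSS0, h6⟩ := eq_zero_of_stein_output hF hX (hLS.fromBlocks_diagonal hSO) hSS h4
  refine ⟨hSS0, fun k => Matrix.ext_of_mulVec_single fun j => ?_⟩
  generalize (Pi.single j 1 : Fin p → ℝ) = t
  have hY : Matrix.fromBlocks (L * SS * Lᵀ) 0 0 SO *ᵥ Sum.elim (0 : Fin p → ℝ) t =
      Sum.elim (0 : Fin p → ℝ) (SO *ᵥ t) := by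
    rw [Matrix.fromBlocks_mulVec]
    simp
  have hout : ∀ k, Matrix.fromCols C (-C) *ᵥ errorMatrix A B C K L ^ k *ᵥ
      Sum.elim (0 : Fin p → ℝ) (SO *ᵥ t) = 0 := fun k => by
    rw [← hY, Matrix.mulVec_mulVec, Matrix.mulVec_mulVec, h6,
      Matrix.zero_mulVec]
  -- Joint induction: zero output at step `k` kills the coupling `-(L C)`, so the error coordinate
  -- remains zero at step `k + 1`, and zero output there again concerns the false state alone.
  have hpow : ∀ k, errorMatrix A B C K L ^ k *ᵥ Sum.elim (0 : Fin p → ℝ) (SO *ᵥ t) =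
      Sum.elim (0 : Fin p → ℝ) ((A + B * K) ^ k *ᵥ SO *ᵥ t) ∧ C *ᵥ (A + B * K) ^ k *ᵥ SO *ᵥ t = 0 := by
    have hC : ∀ k, errorMatrix A B C K L ^ k *ᵥ Sum.elim (0 : Fin p → ℝ) (SO *ᵥ t) =
        Sum.elim (0 : Fin p → ℝ) ((A + B * K) ^ k *ᵥ SO *ᵥ t) → C *ᵥ (A + B * K) ^ k *ᵥ SO *ᵥ t = 0 := by
      intro k hk
      have h7 := hout k
      rw [hk, Matrix.fromCols_mulVec_sumElim, Matrix.mulVec_zero, zero_add,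
        Matrix.neg_mulVec] at h7
      exact neg_eq_zero.1 h7
    intro k
    induction k with
    | zero => exact ⟨by simp, hC 0 (by simp)⟩
    | succ k ih =>
      have h8 : errorMatrix A B C K L ^ (k + 1) *ᵥ Sum.elim (0 : Fin p → ℝ) (SO *ᵥ t) =
          Sum.elim (0 : Fin p → ℝ) ((A + B * K) ^ (k + 1) *ᵥ SO *ᵥ t) := by
        rw [pow_succ', ← Matrix.mulVec_mulVec, ih.1, pow_succ' (A + B * K),
          ← Matrix.mulVec_mulVec (SO *ᵥ t), errorMatrix,
          ← Matrix.fromRows_fromCols_eq_fromBlocks]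
        simp only [Matrix.fromRows_mulVec, Matrix.fromCols_mulVec_sumElim, Matrix.neg_mulVec,
          ← Matrix.mulVec_mulVec _ L C, ih.2, Matrix.mulVec_zero, neg_zero, add_zero, zero_add]
      exact ⟨h8, hC _ h8⟩
  rw [Matrix.zero_mulVec]
  simpa only [Matrix.mulVec_mulVec, Matrix.mul_assoc] using (hpow k).2

/-- An invisible attack has zero average power. -/
theorem hasZeroAveragePower_of_covariance_eq_zero
    (hη : IsWhiteNoise P ℱ (jointNoise w z e ζ ω) (jointCov SW SZ SE SS SO) c)
    (hξ₀ : Measurable[ℱ 0] (ξ 0)) (hK : IsSchurStable (A + B * K))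
    (hattack : IsAttack A B C K 0 x ξ z v ζ ω) (hSS : SS = 0)
    (hSO : ∀ k : ℕ, C * (A + B * K) ^ k * SO = 0) : HasZeroAveragePower P v := by
  have hF : Tendsto (fun n : ℕ => (A + B * K) ^ n) atTop (𝓝 0) :=
    tendsto_pow_of_spectrum_lt_one _ hK
  let G : Matrix (Fin p) (NoiseIndex p q m) ℝ :=
    .fromCols 0 (.fromCols 0 (.fromCols 0 (.fromCols 0 1)))
  let D : Matrix (Fin m) (NoiseIndex p q m) ℝ :=
    .fromCols 0 (.fromCols 0 (.fromCols 0 (.fromCols 1 0)))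
  have hG : G * jointCov SW SZ SE SS SO * Gᵀ = SO := by
    simp only [G, jointCov, Matrix.fromCols_mul_fromBlocks, Matrix.transpose_fromCols,
      Matrix.fromCols_mul_fromRows]
    simp [Matrix.fromCols_mul_fromRows]
  have hD : D * jointCov SW SZ SE SS SO * Dᵀ = 0 := by
    simp only [D, jointCov, Matrix.fromCols_mul_fromBlocks, Matrix.transpose_fromCols,
      Matrix.fromCols_mul_fromRows]
    simp [hSS]
  obtain ⟨X, hX⟩ := exists_stein hF SO
  -- `X` is the limit of the sums of `(A + B K)^k Σ_O ((A + B K)^k)ᵀ`, each of which `C`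
  -- annihilates.
  have hCX : C * X = 0 := by
    have hc : Continuous fun Z : Matrix (Fin p) (Fin p) ℝ => C * Z := by fun_prop
    refine tendsto_nhds_unique ((hc.tendsto X).comp (tendsto_sum_of_stein hF hX)) ?_
    refine tendsto_const_nhds.congr fun n => ?_
    simp only [Function.comp_apply, Matrix.mul_sum, ← Matrix.mul_assoc, hSO, Matrix.zero_mul,
      Finset.sum_const_zero]
  have hstate : ∀ n a, ξ (n + 1) a =
      (A + B * K) *ᵥ ξ n a + G *ᵥ jointNoise w z e ζ ω n a := fun n a => by
    simp [hattack.falseState, G, jointNoise]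
  have hout : ∀ n a, v n a = C *ᵥ ξ n a + D *ᵥ jointNoise w z e ζ ω n a := fun n a => by
    simp [hattack.attack, D, jointNoise]
  refine hasZeroAveragePower_of_hasMatMean ?_
  have := ae_hasMatMean_output hη hξ₀ hF hstate hout (X := X) (by rw [hG]; exact hX)
  rwa [hCX, Matrix.zero_mul, hD, add_zero] at this

end Tests

theorem mainTheorem1 {Ω : Type*} [MeasurableSpace Ω] (P : Measure Ω) [IsProbabilityMeasure P]
    {p q m : ℕ}
    (A : Matrix (Fin p) (Fin p) ℝ) (B : Matrix (Fin p) (Fin q) ℝ) (C : Matrix (Fin m) (Fin p) ℝ)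
    (K : Matrix (Fin q) (Fin p) ℝ) (L : Matrix (Fin p) (Fin m) ℝ)
    (SW SO SΔ : Matrix (Fin p) (Fin p) ℝ) (SZ SS : Matrix (Fin m) (Fin m) ℝ)
    (SE : Matrix (Fin q) (Fin q) ℝ) (α : ℝ) (k' : ℕ)
    (x xhat ξ w ω : ℕ → Ω → Fin p → ℝ) (u e : ℕ → Ω → Fin q → ℝ) (y z v ζ : ℕ → Ω → Fin m → ℝ)
    -- the plant and the controller gains
    (_hAB : IsStabilizable A B) (_hAC : IsDetectable A C)
    (hK : IsSchurStable (A + B * K)) (hL : IsSchurStable (A + L * C))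
    -- the noises, the private excitation and the initial states
    (hw : IsGaussianNoise P w SW) (hz : IsGaussianNoise P z SZ) (he : IsGaussianNoise P e SE)
    (hζ : IsGaussianNoise P ζ SS) (hω : IsGaussianNoise P ω SO)
    (hx₀ : Measurable (x 0)) (hxhat₀ : Measurable (xhat 0)) (hξ₀ : Measurable (ξ 0))
    (hindep : SourcesIndependent P (x 0) (xhat 0) (ξ 0) w z e ζ ω)
    -- the dynamics
    (hloop : IsClosedLoop A B C K L x xhat u y v w z e)
    (hattack : IsAttack A B C K α x ξ z v ζ ω)
    -- the assumptions of the tests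
    (hSΔ : IsErrorCovariance A C L SW SZ SΔ)
    (hSE : SE.rank = q)
    (hk' : IsLeast {k : ℕ | C * (A + B * K) ^ k * B ≠ 0} k')
    (htest1 : CovarianceTest P C SZ SΔ xhat y)
    (htest2 : CorrelationTest P C k' xhat y e) :
    α = 0 ∧ HasZeroAveragePower P v := by
  have hle := sigmaAlgebra_le hx₀ hxhat₀ hξ₀ hw.measurable hz.measurable he.measurable
    hζ.measurable hω.measurable
  obtain ⟨c, hη⟩ := exists_isWhiteNoise hle hw hz he hζ hω hindep
  have hinit := measurable_initial hle
  have hx : Measurable[sourceFiltration hle 0] (x 0) := measurable_fst.comp hinit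
  have hxhat : Measurable[sourceFiltration hle 0] (xhat 0) :=
    measurable_fst.comp (measurable_snd.comp hinit)
  have hξ : Measurable[sourceFiltration hle 0] (ξ 0) :=
    measurable_snd.comp (measurable_snd.comp hinit)
  have herr : Measurable[sourceFiltration hle 0] (errorState x xhat ξ 0) :=
    measurable_sumElim (hxhat.sub hx) hξ
  have hα : α = 0 := scaling_eq_zero_of_tests hη (measurable_sumElim hx herr) hloop hattack hSE hk'
    htest1 htest2
  subst hα
  obtain ⟨hSS, hSO⟩ := attack_covariance_eq_zero hη herr hK hL hζ.posSemidef hω.posSemidef hloop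
    hattack hSΔ htest1
  exact ⟨rfl, hasZeroAveragePower_of_covariance_eq_zero hη hξ hK hattack hSS hSO⟩
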